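/- \textbf{Conventions.} A real is an infinite binary sequence $X$, identified with the number $\sum_n X(n)2^{-(n+1)}\in[0,1]$ of which it is a binary expansion (dyadic rationals have two expansions; neither is random in any of the senses below). $X\restriction n$ is the prefix of length $n$, and $|\sigma|$ is the length of a finite binary string $\sigma$. \emph{Randomness.} A prefix-free machine is a partial recursive function $M$ on finite binary strings such that no string of $\operatorname{dom} M$ is a proper prefix of another one; $K_M(\sigma)=\min\{|p| : M(p)=\sigma\}$. Fix a universal prefix-free machine $U$, i.e. one such that for every prefix-free machine $M$ there is a constant $c$ with $K_U(\sigma)\le K_M(\sigma)+c$ for all $\sigma$, and put $K=K_U$. A real $X$ is \emph{Martin-Löf random} if there is a $c$ with $K(X\restriction n)\ge n-c$ for all $n$. A martingale is a function $M$ from finite binary strings to the nonnegative reals with $M(\sigma)=\frac12(M(\sigma0)+M(\sigma1))$ for all $\sigma$; it is recursive if $M(\sigma)$ can be computed, uniformly in $\sigma$, to within any given $2^{-k}$. It \emph{succeeds} on $X$ if $\limsup_n M(X\restriction n)=\infty$; it \emph{Schnorr-succeeds} on $X$ if it succeeds on $X$ and there is a recursive, nondecreasing, unbounded $g:\omega\to\omega$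 with $g(n)\le M(X\restriction n)$ for infinitely many $n$. A real $X$ is \emph{computably random} if no recursive martingale succeeds on $X$, and \emph{Schnorr random} if no recursive martingale Schnorr-succeeds on $X$. \emph{Numberings.} A number in $[0,1]$ is \emph{left-r.e.} if it equals $\sum_{\sigma\in\operatorname{dom} f}2^{-|\sigma|}$ for some partial recursive function $f$ on finite binary strings. A \emph{left-r.e. numbering} is a map $\alpha:\omega\to[0,1]$ of the form $\alpha_e=\sum_{\sigma\in\operatorname{dom}\varphi_e}2^{-|\sigma|}$, where $(e,\sigma)\mapsto\varphi_e(\sigma)$ is partial recursive. It is \emph{universal} if its range consists of all left-r.e. reals, and \emph{acceptable} if for every left-r.e. numbering $\beta$ there is a recursive function $f$ with $\alpha_{f(e)}=\beta_e$ for all $e$. A set $B\subseteq\omega$ is \emph{$\Sigma_3$-hard} if for every $\Sigma^0_3$ set $A\subseteq\omega$ there is a recursive $f$ with $x\in A\iff f(x)\in B$ for all $x$. \textbf{Theorem.} Let $\alpha$ be an acceptable universal left-r.e. numbering. For every $\Sigma^0_3$ set $A\subseteq\omega$ there is a recursive function $g:\omega\to\omega$ such that for all $x$, \[ x\in A\implies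 \alpha_{g(x)}\text{ is Martin-Löf random},\qquad x\notin A\implies \alpha_{g(x)}\text{ is not Schnorr random}. \] Consequently the index sets $\{e:\alpha_e\text{ is Martin-Löf random}\}$, $\{e:\alpha_e\text{ is computably random}\}$ and $\{e:\alpha_e\text{ is Schnorr random}\}$ are $\Sigma_3$-hard. -/

import Mathlib

namespace LeftRE

/-! ### Binary sequences and the reals they represent -/

/-- The prefix of length `n` of an infinite binary sequence. -/
def pre (X : ℕ → Bool) (n : ℕ) : List Bool := (List.range n).map X

/-- The number in `[0,1]` with binary expansion `0.X(0)X(1)X(2)...`. -/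
noncomputable def binaryValue (X : ℕ → Bool) : ℝ :=
  ∑' n : ℕ, if X n then ((2 : ℝ) ^ (n + 1))⁻¹ else 0

/-! ### Prefix-free machines and prefix-free complexity -/

/-- A prefix-free machine: a partial recursive function on finite binary strings, no two distinct
members of whose domain are prefixes of one another. -/
def IsPrefixMachine (M : List Bool →. List Bool) : Prop :=
  Partrec M ∧ ∀ p q, (M p).Dom → (M q).Dom → p <+: q → p = q

/-- `K_M(σ)`, the least length of a program `p` with `M(p) = σ`; it is `⊤` if there is none. -/
noncomputable def complexity (M : List Bool →. List Bool) (σ : List Bool) : ℕ∞ :=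
  ⨅ p ∈ {p : List Bool | σ ∈ M p}, (p.length : ℕ∞)

/-- A universal prefix-free machine. -/
def IsUniversalMachine (U : List Bool →. List Bool) : Prop :=
  IsPrefixMachine U ∧
    ∀ M, IsPrefixMachine M → ∃ c : ℕ, ∀ σ, complexity U σ ≤ complexity M σ + c

section Existence

/-! Existence of a universal prefix-free machine. The string `1^c 0 q` is the program that runs the
`c`-th program on `q`. All halting computations are enumerated, and one is accepted only if its
program is incomparable with the programs accepted before. -/

open Nat.Partrec (Code)
open Encodable Denumerable

/-- The string coded by `n`. -/
def str (n : ℕ) : List Bool := (decode n : Option (List Bool)).getD []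

/-- The program `1^c 0 q`. -/
def prog (c : ℕ) (q : List Bool) : List Bool := (List.range c).map (fun _ => true) ++ false :: q

/-- The computation examined at stage `t`, if it halts in time: its program and its output. -/
def step (t : ℕ) : Option (List Bool × List Bool) :=
  (Code.evaln t.unpair.1 (ofNat Code t.unpair.2.unpair.1) t.unpair.2.unpair.2).map fun v =>
    (prog t.unpair.2.unpair.1 (str t.unpair.2.unpair.2), str v)

/-- Incomparability of two strings. -/
def Incomp (p q : List Bool) : Prop := ¬ (q.take p.length = p) ∧ ¬ (p.take q.length = q)

instance (p q : List Bool) : Decidable (Incomp p q) := by unfold Incomp; infer_instance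

/-- The computations accepted before stage `t`. -/
def acc : ℕ → List (List Bool × List Bool)
  | 0 => []
  | t + 1 => match step t with
    | none => acc t
    | some r => if ∀ s ∈ acc t, Incomp s.1 r.1 then r :: acc t else acc t

/-- The machine given by the accepted computations. -/
def univMachine (p : List Bool) : Part (List Bool) :=
  Nat.rfindOpt fun t => (acc t).lookup p

theorem primrec_str : Primrec str := Primrec.option_getD.comp Primrec.decode (Primrec.const [])

theorem str_encode (q : List Bool) : str (encode q) = q := by simp [str]

theorem primrec_prog : Primrec₂ prog := by
  refine Primrec.list_append.comp (Primrec.list_map (Primrec.list_range.comp Primrec.fst)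
    (Primrec.const true).to₂) (Primrec.list_cons.comp (Primrec.const false) Primrec.snd)

theorem primrec_step : Primrec step := by
  have h1 : Primrec fun t : ℕ => t.unpair.1 := Primrec.fst.comp Primrec.unpair
  have h2 : Primrec fun t : ℕ => t.unpair.2.unpair.1 :=
    Primrec.fst.comp (Primrec.unpair.comp (Primrec.snd.comp Primrec.unpair))
  have h3 : Primrec fun t : ℕ => t.unpair.2.unpair.2 :=
    Primrec.snd.comp (Primrec.unpair.comp (Primrec.snd.comp Primrec.unpair))
  refine Primrec.option_map
    (Code.primrec_evaln.comp ((h1.pair ((Primrec.ofNat Code).comp h2)).pair h3)) ?_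
  refine Primrec.pair ?_ (primrec_str.comp Primrec.snd)
  exact primrec_prog.comp (h2.comp Primrec.fst)
    (primrec_str.comp (h3.comp Primrec.fst))

theorem primrec_incomp : PrimrecRel
    (fun (s r : List Bool × List Bool) => Incomp s.1 r.1) := by
  have key : ∀ {f g : (List Bool × List Bool) × (List Bool × List Bool) → List Bool},
      Primrec f → Primrec g → PrimrecPred fun x => ¬ ((g x).take (f x).length = f x) := by
    intro f g hf hg
    exact (Primrec.eq.comp (Primrec.list_take.comp (Primrec.list_length.comp hf) hg) hf).not
  exact (key (Primrec.fst.comp Primrec.fst) (Primrec.fst.comp Primrec.snd)).and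
    (key (Primrec.fst.comp Primrec.snd) (Primrec.fst.comp Primrec.fst))

theorem primrec_acc : Primrec acc := by
  let nxt : ℕ × List (List Bool × List Bool) → List (List Bool × List Bool) := fun x =>
    Option.casesOn (step x.1) x.2
      (fun r => if ∀ s ∈ x.2, Incomp s.1 r.1 then r :: x.2 else x.2)
  have hn : Primrec nxt := by
    refine Primrec.option_casesOn (primrec_step.comp Primrec.fst) Primrec.snd ?_
    refine Primrec.ite ?_ (Primrec.list_cons.comp Primrec.snd (Primrec.snd.comp Primrec.fst))
      (Primrec.snd.comp Primrec.fst)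
    exact (primrec_incomp.forall_mem_list).comp (Primrec.snd.comp Primrec.fst) Primrec.snd
  refine (Primrec.nat_rec₁ (f := fun n l => nxt (n, l)) [] hn.to₂).of_eq fun t => ?_
  induction t with
  | zero => rfl
  | succ t ih =>
    simp only [nxt] at ih ⊢
    rw [acc, ih]
    cases step t <;> rfl

theorem partrec_univMachine : Partrec univMachine := by
  have h : Primrec₂ fun (p : List Bool) (t : ℕ) => (acc t).lookup p := by
    have e : (List.instBEq : BEq (List Bool)) = instBEqOfDecidableEq := lawful_beq_subsingleton _ _
    rw [e]
    exact Primrec.listLookup.comp Primrec.fst (primrec_acc.comp Primrec.snd)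
  exact Partrec.rfindOpt h.to_comp

theorem acc_mono {s t : ℕ} (h : s ≤ t) : acc s ⊆ acc t := by
  induction h with
  | refl => exact fun _ h => h
  | step _ ih =>
    intro r hr
    rw [acc]
    split
    · exact ih hr
    · split
      · exact List.mem_cons_of_mem _ (ih hr)
      · exact ih hr

theorem step_of_mem_acc {t : ℕ} {r} (h : r ∈ acc t) : ∃ s, step s = some r := by
  induction t with
  | zero => simp [acc] at h
  | succ t ih =>
    rw [acc] at h
    split at h
    · exact ih h
    · rename_i r' hr'
      split at h
      · rcases List.mem_cons.1 h with rfl | h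
        · exact ⟨t, hr'⟩
        · exact ih h
      · exact ih h

theorem acc_prefixFree {t : ℕ} {r s} (hr : r ∈ acc t) (hs : s ∈ acc t) (h : r.1 <+: s.1) :
    r.1 = s.1 := by
  induction t with
  | zero => simp [acc] at hr
  | succ t ih =>
    rw [acc] at hr hs
    split at hr
    · rename_i h0
      rw [h0] at hs
      exact ih hr hs
    · rename_i x hx
      rw [hx] at hs
      simp only at hs
      split at hr
      · rename_i hi
        rw [if_pos hi] at hs
        rcases List.mem_cons.1 hr with rfl | hr <;> rcases List.mem_cons.1 hs with rfl | hs
        · rfl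
        · exact absurd (List.prefix_iff_eq_take.1 h).symm (hi _ hs).2
        · exact absurd (List.prefix_iff_eq_take.1 h).symm (hi _ ‹_›).1
        · exact ih hr hs
      · rename_i hi
        rw [if_neg hi] at hs
        exact ih hr hs

theorem mem_of_lookup {l : List (List Bool × List Bool)} {p v : List Bool}
    (h : l.lookup p = some v) : (p, v) ∈ l := by
  induction l with
  | nil => simp at h
  | cons a l ih =>
    obtain ⟨a, b⟩ := a
    rw [List.lookup_cons] at h
    split at h
    · rename_i he
      have := eq_of_beq he
      simp_all
    · exact List.mem_cons_of_mem _ (ih h)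

theorem lookup_isSome {l : List (List Bool × List Bool)} {p v : List Bool}
    (h : (p, v) ∈ l) : ∃ w, l.lookup p = some w := by
  induction l with
  | nil => simp at h
  | cons a l ih =>
    obtain ⟨a, b⟩ := a
    rw [List.lookup_cons]
    split
    · exact ⟨_, rfl⟩
    · rename_i he
      rcases List.mem_cons.1 h with h | h
      · simp_all
      · exact ih h

theorem prog_comparable {c d : ℕ} {q r : List Bool} (h : prog c q <+: prog d r) :
    c = d ∧ q <+: r := by
  have e : ∀ n q, prog n q = List.replicate n true ++ false :: q := by
    intro n q
    simp [prog]
  rw [e, e] at h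
  induction c generalizing d with
  | zero =>
    cases d with
    | zero => simpa using h
    | succ d => simp [List.replicate_succ] at h
  | succ c ih =>
    cases d with
    | zero => simp [List.replicate_succ] at h
    | succ d =>
      simp only [List.replicate_succ, List.cons_append, List.cons_prefix_cons, true_and] at h
      have := ih h
      exact ⟨by omega, this.2⟩

theorem exists_universal : ∃ U, IsUniversalMachine U := by
  refine ⟨univMachine, ⟨partrec_univMachine, ?_⟩, ?_⟩
  · intro p q hp hq h
    obtain ⟨t, v, hv⟩ := Nat.rfindOpt_dom.1 hp
    obtain ⟨t', v', hv'⟩ := Nat.rfindOpt_dom.1 hq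
    exact acc_prefixFree (r := (p, v)) (s := (q, v'))
      (acc_mono (le_max_left t t') (mem_of_lookup hv))
      (acc_mono (le_max_right t t') (mem_of_lookup hv')) h
  · rintro M ⟨hM, hpf⟩
    obtain ⟨c, hc⟩ := Code.exists_code.1 hM
    have sound : ∀ s q v, step s = some (prog (encode c) q, v) → v ∈ M q := by
      intro s q v h
      simp only [step, Option.map_eq_some_iff, Prod.mk.injEq] at h
      obtain ⟨w, hw, h1, h2⟩ := h
      have h3 := (prog_comparable (h1.symm ▸ List.prefix_rfl :
        prog (encode c) q <+: prog s.unpair.2.unpair.1 (str s.unpair.2.unpair.2))).1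
      have h4 := (prog_comparable (h1.symm ▸ List.prefix_rfl :
        prog (encode c) q <+: prog s.unpair.2.unpair.1 (str s.unpair.2.unpair.2))).2
      have h5 := (prog_comparable (h1 ▸ List.prefix_rfl :
        prog s.unpair.2.unpair.1 (str s.unpair.2.unpair.2) <+: prog (encode c) q)).2
      have h6 : q = str s.unpair.2.unpair.2 :=
        h4.eq_of_length (le_antisymm h4.length_le h5.length_le)
      have := Code.evaln_sound hw
      rw [← h3, ofNat_encode, hc] at this
      simp only [Part.mem_bind_iff, Part.mem_map_iff, Part.mem_ofOption, Option.mem_def] at this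
      obtain ⟨a, ha, b, hb, hw'⟩ := this
      rw [← h2, ← hw', str_encode, h6, str, ha]
      exact hb
    have total : ∀ q v, v ∈ M q → v ∈ univMachine (prog (encode c) q) := by
      intro q v hv
      have h1 : encode v ∈ Code.eval c (encode q) := by
        rw [hc]
        simpa using hv
      obtain ⟨k, hk⟩ := Code.evaln_complete.1 h1
      have h2 : step (Nat.pair k (Nat.pair (encode c) (encode q))) =
          some (prog (encode c) q, v) := by
        rw [Option.mem_def] at hk
        simp [step, hk, str_encode]
      have h3 : ∃ t w, (prog (encode c) q, w) ∈ acc t := by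
        by_cases hi : ∀ s ∈ acc (Nat.pair k (Nat.pair (encode c) (encode q))),
            Incomp s.1 (prog (encode c) q)
        · refine ⟨Nat.pair k (Nat.pair (encode c) (encode q)) + 1, v, ?_⟩
          rw [acc, h2]
          simp only
          rw [if_pos hi]
          exact List.mem_cons_self
        · simp only [not_forall] at hi
          obtain ⟨⟨p, w⟩, hs, hi⟩ := hi
          refine ⟨Nat.pair k (Nat.pair (encode c) (encode q)), w, ?_⟩
          obtain ⟨t, ht⟩ := step_of_mem_acc hs
          have hp : ∃ d r, p = prog d r := by
            simp only [step, Option.map_eq_some_iff, Prod.mk.injEq] at ht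
            obtain ⟨_, -, h, -⟩ := ht
            exact ⟨_, _, h.symm⟩
          obtain ⟨d, r, rfl⟩ := hp
          have hcmp : prog d r <+: prog (encode c) q ∨ prog (encode c) q <+: prog d r := by
            by_contra hcon
            push Not at hcon
            exact hi ⟨fun h => hcon.1 (List.prefix_iff_eq_take.2 h.symm),
              fun h => hcon.2 (List.prefix_iff_eq_take.2 h.symm)⟩
          have hd : d = encode c := by
            rcases hcmp with h | h
            · exact (prog_comparable h).1
            · exact (prog_comparable h).1.symm
          subst hd
          have hr := Part.dom_iff_mem.2 ⟨_, sound _ _ _ ht⟩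
          have hq := Part.dom_iff_mem.2 ⟨_, hv⟩
          have : r = q := by
            rcases hcmp with h | h
            · exact hpf _ _ hr hq (prog_comparable h).2
            · exact (hpf _ _ hq hr (prog_comparable h).2).symm
          subst this
          exact hs
      obtain ⟨t, w, h3⟩ := h3
      obtain ⟨w', hw'⟩ := lookup_isSome h3
      have hdom : (univMachine (prog (encode c) q)).Dom := Nat.rfindOpt_dom.2 ⟨t, w', hw'⟩
      obtain ⟨u, hu⟩ := Part.dom_iff_mem.1 hdom
      obtain ⟨t', ht'⟩ := Nat.rfindOpt_spec hu
      obtain ⟨s, hs⟩ := step_of_mem_acc (mem_of_lookup ht')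
      rwa [Part.mem_unique hv (sound _ _ _ hs)]
    refine ⟨encode c + 1, fun σ => ?_⟩
    unfold complexity
    by_cases hne : ∃ p, σ ∈ M p
    · have : Nonempty {p : List Bool // p ∈ {p : List Bool | σ ∈ M p}} :=
        ⟨⟨hne.choose, hne.choose_spec⟩⟩
      rw [iInf_subtype' (p := fun p => p ∈ {p : List Bool | σ ∈ M p})]
      obtain ⟨⟨p, hp⟩, he⟩ := ENat.exists_eq_iInf
        (fun p : {p : List Bool // p ∈ {p : List Bool | σ ∈ M p}} => (p.1.length : ℕ∞))
      rw [← he]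
      refine (iInf₂_le (prog (encode c) p) (total p σ hp)).trans ?_
      simp only [prog, List.length_append, List.length_map, List.length_range, List.length_cons]
      norm_cast
      omega
    · have : (⨅ p ∈ {p : List Bool | σ ∈ M p}, (p.length : ℕ∞)) = ⊤ := by
        simp only [iInf_eq_top]
        exact fun p hp => absurd ⟨p, hp⟩ hne
      rw [this]
      simp

end Existence

/-- The fixed universal prefix-free machine. -/
noncomputable def U : List Bool →. List Bool := exists_universal.choose

/-- Prefix-free complexity `K = K_U`. -/
noncomputable def K (σ : List Bool) : ℕ∞ := complexity U σ

/-! ### Randomness of binary sequences -/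

/-- `X` is Martin-Löf random: `∃ c, ∀ n, K(X ↾ n) ≥ n - c`. -/
def MLRandomSeq (X : ℕ → Bool) : Prop := ∃ c : ℕ, ∀ n : ℕ, (n : ℕ∞) ≤ K (pre X n) + c

/-- A martingale: a nonnegative function on strings with the fairness condition. -/
def IsMartingale (M : List Bool → ℝ) : Prop :=
  (∀ σ, 0 ≤ M σ) ∧ ∀ σ, M σ = (M (σ ++ [false]) + M (σ ++ [true])) / 2

/-- A nonnegative real-valued function on strings is recursive if it can be approximated by dyadic
rationals, effectively to within any `2^(-k)`. -/
def IsRecursiveReal (M : List Bool → ℝ) : Prop :=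
  ∃ a : List Bool → ℕ → ℕ, Computable₂ a ∧ ∀ σ k, |M σ - (a σ k : ℝ) / 2 ^ k| ≤ 1 / 2 ^ k

/-- `M` succeeds on `X`: `limsup M(X ↾ n) = ∞`. -/
def Succeeds (M : List Bool → ℝ) (X : ℕ → Bool) : Prop :=
  ∀ C : ℝ, ∃ᶠ n in Filter.atTop, C < M (pre X n)

/-- `M` Schnorr-succeeds on `X`: it succeeds, and `g(n) ≤ M(X ↾ n)` infinitely often for some
recursive, nondecreasing and unbounded `g`. -/
def SchnorrSucceeds (M : List Bool → ℝ) (X : ℕ → Bool) : Prop :=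
  Succeeds M X ∧ ∃ g : ℕ → ℕ, Computable g ∧ Monotone g ∧ (∀ b, ∃ n, b ≤ g n) ∧
    ∃ᶠ n in Filter.atTop, (g n : ℝ) ≤ M (pre X n)

/-- `X` is computably random. -/
def ComputablyRandomSeq (X : ℕ → Bool) : Prop :=
  ¬ ∃ M, IsMartingale M ∧ IsRecursiveReal M ∧ Succeeds M X

/-- `X` is Schnorr random. -/
def SchnorrRandomSeq (X : ℕ → Bool) : Prop :=
  ¬ ∃ M, IsMartingale M ∧ IsRecursiveReal M ∧ SchnorrSucceeds M X

/-! ### Randomness of real numbers: randomness of a binary expansion.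
Dyadic rationals have two expansions; neither is random. -/

/-- The number `r` is Martin-Löf random. -/
def MLRandom (r : ℝ) : Prop := ∃ X, binaryValue X = r ∧ MLRandomSeq X

/-- The number `r` is computably random. -/
def ComputablyRandom (r : ℝ) : Prop := ∃ X, binaryValue X = r ∧ ComputablyRandomSeq X

/-- The number `r` is Schnorr random. -/
def SchnorrRandom (r : ℝ) : Prop := ∃ X, binaryValue X = r ∧ SchnorrRandomSeq X

/-! ### Left-r.e. reals and numberings -/

/-- `r = ∑ 2^(-|σ|)`, the sum over the domain of the partial function `f` on strings. -/
def IsDomainSum (f : List Bool →. ℕ) (r : ℝ) : Prop :=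
  HasSum (fun σ : {σ : List Bool // (f σ).Dom} => ((2 : ℝ) ^ σ.1.length)⁻¹) r

/-- A left-r.e. real: a number in `[0,1]` that is the domain sum of a partial recursive function. -/
def IsLeftRE (r : ℝ) : Prop :=
  r ∈ Set.Icc (0 : ℝ) 1 ∧ ∃ f : List Bool →. ℕ, Partrec f ∧ IsDomainSum f r

/-- A left-r.e. numbering (of its range, a class of left-r.e. reals): the map
`e ↦ ∑_{σ ∈ dom φ_e} 2^(-|σ|)` for a numbering `φ`, with all values in `[0,1]`. -/
def IsLeftRENumbering (α : ℕ → ℝ) : Prop :=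
  (∀ e, α e ∈ Set.Icc (0 : ℝ) 1) ∧
    ∃ φ : ℕ → List Bool →. ℕ, Partrec₂ φ ∧ ∀ e, IsDomainSum (φ e) (α e)

/-- A universal left-r.e. numbering: its range is the class of all left-r.e. reals. -/
def IsUniversalLeftRENumbering (α : ℕ → ℝ) : Prop :=
  IsLeftRENumbering α ∧ Set.range α = {r | IsLeftRE r}

/-- An acceptable left-r.e. numbering: every left-r.e. numbering translates recursively into it. -/
def IsAcceptableLeftRENumbering (α : ℕ → ℝ) : Prop :=
  IsLeftRENumbering α ∧ ∀ β, IsLeftRENumbering β →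
    ∃ f : ℕ → ℕ, Computable f ∧ ∀ e, α (f e) = β e

/-! ### `Σ₃` sets and `Σ₃`-hardness -/

/-- `A` is a `Σ⁰₃` set of natural numbers. -/
def IsSigma3 (A : Set ℕ) : Prop :=
  ∃ R : ℕ × ℕ × ℕ × ℕ → Prop, ComputablePred R ∧
    ∀ x, x ∈ A ↔ ∃ a, ∀ b, ∃ c, R (x, a, b, c)

/-- `B` is `Σ₃`-hard: every `Σ₃` set is many-one reducible to `B`. -/
def IsSigma3Hard (B : Set ℕ) : Prop :=
  ∀ A : Set ℕ, IsSigma3 A → ManyOneReducible (fun x => x ∈ A) (fun e => e ∈ B)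

end LeftRE

/-!
Insert blocks of zeros into the binary expansion of a random left-r.e. real. A number with
infinitely many sufficiently long blocks of zeros is not even Schnorr random, whereas finitely many
blocks change the expansion only up to a shift of a tail, which preserves Martin-Löf randomness.
The construction arranges that finitely many blocks remain precisely when `x ∈ A`.

*The random real.* Half of Chaitin's halting probability is approximated from below by the dyadic
rationals `haltNum c s / 2 ^ s`. Their digits converge to a sequence `X`
(`exists_limit_digits`), and `X` is Martin-Löf random since a prefix of length `n` reveals a stage
by which all programs shorter than `n` that ever halt have halted (`IsCodeU.mlRandomSeq`).

*The blocks.* A `Σ₃` set has the form `{x | liminf_t h(x, t) < ∞}` with `h` recursive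
(`IsSigma3.exists_liminf`). At stage `j` block `j`, consisting of `4 ^ (j + 1)` zeros, is inserted
before digit `j`; it is removed at the first later stage `t` with `h t ≤ h j`. If the limit inferior
is finite, only finitely many blocks are permanent; if `h` tends to infinity, infinitely many are
(`MLRandomSeq.spreadSeq_limPlace`, `exists_permanent`).

*Monotonicity.* The stages form a nondecreasing sequence of dyadic rationals. Inserting block `j` at
stage `j` has no effect, because the approximation has only `j` digits by then; removing a block
moves digits to more significant places; and for fixed places, a greater numeral gives a greater
number, because the places are strictly increasing (`spread_mono`). Hence the limit is left-r.e.,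
uniformly in `x` (`exists_numbering`), and acceptability translates it into the given numbering.

*Non-randomness.* A martingale with one account per starting position, each betting on zeros only,
has capital at least `2 ^ (m - 1)` after zeros at all positions from `m` to `3 * m - 1`
(`not_schnorrRandomSeq_of_blocks`). A real with a second expansion has only expansions that are
eventually constant, to which the same martingale or its mirror image applies.

*Index sets.* Martin-Löf random sequences are computably random: by Ville's inequality
(`IsMartingale.sum_le`) the strings where a recursive martingale gets large have small weight, and
a prefix-free machine compresses them (`exists_machine`).
-/

namespace LeftRE

open Filter Topology
open Nat.Partrec (Code)

/-! ### Computability of arithmetic operations and bounded sums -/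

theorem computable_sum_range {α : Type*} [Primcodable α] {f : α → ℕ → ℕ} {n : α → ℕ}
    (hf : Computable₂ f) (hn : Computable n) :
    Computable fun a => ∑ i ∈ Finset.range (n a), f a i := by
  refine (Computable.nat_rec hn (Computable.const 0) (h := fun a p => p.2 + f a p.1) ?_).of_eq ?_
  · exact Primrec.nat_add.to_comp.comp (Computable.snd.comp Computable.snd)
      (hf.comp Computable.fst (Computable.fst.comp Computable.snd))
  · intro a
    induction n a with
    | zero => rfl
    | succ k ih => rw [Finset.sum_range_succ, ← ih]

theorem computable_pow {α : Type*} [Primcodable α] {f g : α → ℕ}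
    (hf : Computable f) (hg : Computable g) : Computable fun a => f a ^ g a := by
  refine (Computable.nat_rec hg (Computable.const 1) (h := fun a p => p.2 * f a) ?_).of_eq ?_
  · exact Primrec.nat_mul.to_comp.comp (Computable.snd.comp Computable.snd)
      (hf.comp Computable.fst)
  · intro a
    induction g a with
    | zero => simp
    | succ k ih => rw [pow_succ, ← ih]

theorem computable_add {α : Type*} [Primcodable α] {f g : α → ℕ}
    (hf : Computable f) (hg : Computable g) : Computable fun a => f a + g a :=
  Primrec.nat_add.to_comp.comp hf hg

theorem computable_sub {α : Type*} [Primcodable α] {f g : α → ℕ}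
    (hf : Computable f) (hg : Computable g) : Computable fun a => f a - g a :=
  Primrec.nat_sub.to_comp.comp hf hg

theorem computable_mul {α : Type*} [Primcodable α] {f g : α → ℕ}
    (hf : Computable f) (hg : Computable g) : Computable fun a => f a * g a :=
  Primrec.nat_mul.to_comp.comp hf hg

theorem computable_div {α : Type*} [Primcodable α] {f g : α → ℕ}
    (hf : Computable f) (hg : Computable g) : Computable fun a => f a / g a :=
  Primrec.nat_div.to_comp.comp hf hg

theorem computable_mod {α : Type*} [Primcodable α] {f g : α → ℕ}
    (hf : Computable f) (hg : Computable g) : Computable fun a => f a % g a :=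
  Primrec.nat_mod.to_comp.comp hf hg

theorem computable_decide_le {α : Type*} [Primcodable α] {f g : α → ℕ}
    (hf : Computable f) (hg : Computable g) : Computable fun a => decide (f a ≤ g a) :=
  (PrimrecRel.decide Primrec.nat_le).to_comp.comp hf hg

theorem computable_decide_lt {α : Type*} [Primcodable α] {f g : α → ℕ}
    (hf : Computable f) (hg : Computable g) : Computable fun a => decide (f a < g a) :=
  (PrimrecRel.decide Primrec.nat_lt).to_comp.comp hf hg

theorem computable_decide_eq {α : Type*} [Primcodable α] {f g : α → ℕ}
    (hf : Computable f) (hg : Computable g) : Computable fun a => decide (f a = g a) :=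
  (PrimrecRel.decide Primrec.eq).to_comp.comp hf hg

theorem computable_and {α : Type*} [Primcodable α] {f g : α → Bool}
    (hf : Computable f) (hg : Computable g) : Computable fun a => f a && g a :=
  Primrec.and.to_comp.comp hf hg

theorem computable_ite {α β : Type*} [Primcodable α] [Primcodable β] {c : α → Bool} {f g : α → β}
    (hc : Computable c) (hf : Computable f) (hg : Computable g) :
    Computable fun a => if c a = true then f a else g a :=
  (Computable.cond hc hf hg).of_eq fun a => by cases c a <;> rfl

/-! ### Strings as binary numerals -/

/-- The number whose binary numeral is `σ`, most significant bit first. -/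
def val (σ : List Bool) : ℕ := σ.foldl (fun a b => 2 * a + b.toNat) 0

theorem val_append_singleton (σ : List Bool) (b : Bool) : val (σ ++ [b]) = 2 * val σ + b.toNat := by
  simp [val]

theorem val_append (σ τ : List Bool) : val (σ ++ τ) = val σ * 2 ^ τ.length + val τ := by
  induction τ using List.reverseRecOn with
  | nil => simp [val]
  | append_singleton τ b ih =>
    rw [← List.append_assoc, val_append_singleton, val_append_singleton, ih]
    simp only [List.length_append, List.length_singleton, pow_succ]
    ring

theorem val_lt (σ : List Bool) : val σ < 2 ^ σ.length := by
  induction σ using List.reverseRecOn with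
  | nil => simp [val]
  | append_singleton σ b ih =>
    rw [val_append_singleton, List.length_append, List.length_singleton, pow_succ]
    cases b <;> simp <;> omega

theorem exists_val (n m : ℕ) (h : m < 2 ^ n) : ∃ σ : List Bool, σ.length = n ∧ val σ = m := by
  induction n generalizing m with
  | zero => exact ⟨[], rfl, by simp at h; simp [h, val]⟩
  | succ n ih =>
    obtain ⟨σ, h1, h2⟩ := ih (m / 2) (by rw [pow_succ] at h; omega)
    refine ⟨σ ++ [decide (m % 2 = 1)], by simp [h1], ?_⟩
    rw [val_append_singleton, h2]
    rcases Nat.mod_two_eq_zero_or_one m with h | h <;> simp [h] <;> omega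

theorem val_injective {σ τ : List Bool} (hl : σ.length = τ.length) (hv : val σ = val τ) :
    σ = τ := by
  induction σ using List.reverseRecOn generalizing τ with
  | nil => exact (List.eq_nil_of_length_eq_zero hl.symm).symm
  | append_singleton σ b ih =>
    rcases List.eq_nil_or_concat τ with rfl | ⟨τ, c, rfl⟩
    · simp at hl
    · simp only [List.concat_eq_append] at *
      rw [val_append_singleton, val_append_singleton] at hv
      have hb : b = c ∧ val σ = val τ := by
        cases b <;> cases c <;> simp at hv ⊢ <;> omega
      rw [ih (by simpa using hl) hb.2, hb.1]

theorem computable_val : Computable val := by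
  refine (Primrec.list_foldl (f := fun σ : List Bool => σ) (g := fun _ => 0)
    (h := fun _ (p : ℕ × Bool) => 2 * p.1 + p.2.toNat) Primrec.id (Primrec.const 0) ?_).to_comp
  refine Primrec.nat_add.comp (Primrec.nat_mul.comp (Primrec.const 2)
    (Primrec.fst.comp Primrec.snd)) ?_
  exact (Primrec.dom_bool Bool.toNat).comp (Primrec.snd.comp Primrec.snd)

theorem length_pre (X : ℕ → Bool) (n : ℕ) : (pre X n).length = n := by simp [pre]

theorem pre_succ (X : ℕ → Bool) (n : ℕ) : pre X (n + 1) = pre X n ++ [X n] := by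
  simp [pre, List.range_succ]

theorem pre_add (X : ℕ → Bool) (m n : ℕ) :
    pre X (m + n) = pre X m ++ pre (fun i => X (m + i)) n := by
  simp [pre, List.range_add]

/-! ### Ville's inequality for prefix-free sets of strings -/

/-- A set of strings no member of which is a proper prefix of another. -/
def PrefixFree (S : Set (List Bool)) : Prop := ∀ p ∈ S, ∀ q ∈ S, p <+: q → p = q

/-- Ville's inequality: a martingale cannot be large on average along a prefix-free set. -/
theorem IsMartingale.sum_le {M : List Bool → ℝ} (hM : IsMartingale M) (F : Finset (List Bool))
    (hF : PrefixFree (F : Set (List Bool))) :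
    ∑ σ ∈ F, M σ / 2 ^ σ.length ≤ M [] := by
  obtain ⟨N, hN⟩ : ∃ N, ∀ σ ∈ F, σ.length ≤ N := ⟨F.sup List.length, fun σ h => Finset.le_sup h⟩
  induction N generalizing M F with
  | zero =>
    have hF' : F ⊆ {[]} := fun σ h => by simpa using hN σ h
    refine (Finset.sum_le_sum_of_subset_of_nonneg hF' fun σ _ _ => ?_).trans (by simp)
    exact div_nonneg (hM.1 σ) (by positivity)
  | succ N ih =>
    by_cases h0 : [] ∈ F
    · have hF' : F ⊆ {[]} := fun σ h => by
        simpa using (hF [] h0 σ h List.nil_prefix).symm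
      refine (Finset.sum_le_sum_of_subset_of_nonneg hF' fun σ _ _ => ?_).trans (by simp)
      exact div_nonneg (hM.1 σ) (by positivity)
    · have hinj : ∀ b : Bool, Function.Injective (fun τ : List Bool => b :: τ) :=
        fun b x y h => by simpa using h
      let G : Bool → Finset (List Bool) := fun b => F.preimage (b :: ·) (hinj b).injOn
      have hG : ∀ b, ∑ τ ∈ G b, M (b :: τ) / 2 ^ τ.length ≤ M [b] := by
        intro b
        refine ih (M := fun τ => M (b :: τ)) ⟨fun σ => hM.1 _, fun σ => hM.2 _⟩ _ ?_ ?_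
        · intro p hp q hq h
          simp only [G, Finset.coe_preimage, Set.mem_preimage] at hp hq
          exact hinj b (hF _ hp _ hq (by simpa using h))
        · intro σ h
          simp only [G, Finset.mem_preimage] at h
          simpa using hN _ h
      have hsplit : F = (G false).image (false :: ·) ∪ (G true).image (true :: ·) := by
        ext σ
        simp only [G, Finset.mem_union, Finset.mem_image, Finset.mem_preimage]
        constructor
        · intro h
          rcases σ with _ | ⟨b, τ⟩
          · exact absurd h h0
          · cases b
            · exact Or.inl ⟨τ, h, rfl⟩
            · exact Or.inr ⟨τ, h, rfl⟩
        · rintro (⟨τ, h, rfl⟩ | ⟨τ, h, rfl⟩) <;> exact h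
      have hdisj : Disjoint ((G false).image (false :: ·)) ((G true).image (true :: ·)) := by
        rw [Finset.disjoint_left]
        intro σ h1 h2
        simp only [Finset.mem_image] at h1 h2
        obtain ⟨τ, -, rfl⟩ := h1
        obtain ⟨τ', -, h⟩ := h2
        simp at h
      have hhalf : ∀ b, ∑ σ ∈ (G b).image (b :: ·), M σ / 2 ^ σ.length
          = (∑ τ ∈ G b, M (b :: τ) / 2 ^ τ.length) / 2 := by
        intro b
        rw [Finset.sum_image (fun x _ y _ h => hinj b h), Finset.sum_div]
        refine Finset.sum_congr rfl fun τ _ => ?_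
        rw [List.length_cons, pow_succ, div_div]
      rw [hsplit, Finset.sum_union hdisj, hhalf, hhalf]
      have := hM.2 []
      simp only [List.nil_append] at this
      linarith [hG false, hG true]

/-- Kraft's inequality. -/
theorem kraft (F : Finset (List Bool)) (hF : PrefixFree (F : Set (List Bool))) :
    ∑ σ ∈ F, (1 : ℝ) / 2 ^ σ.length ≤ 1 :=
  IsMartingale.sum_le (M := fun _ => 1) ⟨fun _ => zero_le_one, fun _ => by norm_num⟩ F hF

/-! ### Prefix-free complexity -/

theorem complexity_le {M : List Bool →. List Bool} {p σ : List Bool} (h : σ ∈ M p) :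
    complexity M σ ≤ p.length :=
  iInf₂_le (f := fun p (_ : p ∈ {p : List Bool | σ ∈ M p}) => (p.length : ℕ∞)) p h

theorem le_complexity {M : List Bool →. List Bool} {σ : List Bool} {n : ℕ∞}
    (h : ∀ p, σ ∈ M p → n ≤ p.length) : n ≤ complexity M σ :=
  le_iInf₂ h

theorem isUniversalMachine_U : IsUniversalMachine U := exists_universal.choose_spec

/-- Partial recursive maps raise prefix-free complexity by at most a constant. -/
theorem exists_K_le_of_partrec {f : List Bool →. List Bool} (hf : Partrec f) :
    ∃ c : ℕ, ∀ σ τ, τ ∈ f σ → K τ ≤ K σ + c := by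
  obtain ⟨⟨hU, hpf⟩, huniv⟩ := isUniversalMachine_U
  have hM : IsPrefixMachine fun p => (U p).bind f := by
    refine ⟨hU.bind (hf.comp Computable.snd), fun p q hp hq h => hpf p q ?_ ?_ h⟩
    · exact hp.1
    · exact hq.1
  obtain ⟨c, hc⟩ := huniv _ hM
  refine ⟨c, fun σ τ h => (hc τ).trans ?_⟩
  gcongr
  exact le_complexity fun p hp => complexity_le (Part.mem_bind hp h)

theorem prefix_val {p q : List Bool} (h : p <+: q) :
    (val p : ℝ) / 2 ^ p.length ≤ val q / 2 ^ q.length ∧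
      ((val q : ℝ) + 1) / 2 ^ q.length ≤ (val p + 1) / 2 ^ p.length := by
  obtain ⟨r, rfl⟩ := h
  have h1 : ((val r : ℝ) + 1) ≤ 2 ^ r.length := by exact_mod_cast val_lt r
  have h0 : (0 : ℝ) ≤ val r := by positivity
  rw [val_append, List.length_append, pow_add]
  push_cast
  rw [div_le_div_iff₀ (by positivity) (by positivity),
    div_le_div_iff₀ (by positivity) (by positivity)]
  have hp : (0 : ℝ) < 2 ^ p.length := by positivity
  constructor <;> nlinarith

/-! ### Machines from requests -/

/-- The weight `2^(-n)` of a request `(n, σ)` for a program of length `n` for `σ`. -/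
noncomputable def weight (r : Option (ℕ × List Bool)) : ℝ := r.elim 0 fun x => (1 / 2) ^ x.1

theorem weight_nonneg (r : Option (ℕ × List Bool)) : 0 ≤ weight r := by
  rcases r with _ | x
  · exact le_rfl
  · simp only [weight, Option.elim]; positivity

/-- The common exponent of the denominators of the weights of the requests before `t`. -/
def reqExp (r : ℕ → Option (ℕ × List Bool)) (t : ℕ) : ℕ :=
  ∑ i ∈ Finset.range t, ((r i).map Prod.fst).getD 0

/-- The numerator, over `2 ^ reqExp r t`, of twice the total weight of the requests before `t`. -/
def reqNum (r : ℕ → Option (ℕ × List Bool)) (t : ℕ) : ℕ :=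
  ∑ i ∈ Finset.range t,
    ((r i).map fun x => 2 ^ (reqExp r t + 1 - x.1)).getD 0

/-- The value of the program of length `n` allotted to request number `t`: the least multiple of
`2^(-n)` beyond twice the total weight of the earlier requests. -/
def reqVal (r : ℕ → Option (ℕ × List Bool)) (t n : ℕ) : ℕ :=
  2 ^ n * reqNum r t / 2 ^ reqExp r t + 1

theorem reqNum_eq (r : ℕ → Option (ℕ × List Bool)) (t : ℕ) :
    (reqNum r t : ℝ) / 2 ^ reqExp r t = 2 * ∑ i ∈ Finset.range t, weight (r i) := by
  rw [reqNum, Nat.cast_sum, Finset.sum_div, Finset.mul_sum]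
  refine Finset.sum_congr rfl fun i hi => ?_
  have hle : ((r i).map Prod.fst).getD 0 ≤ reqExp r t :=
    Finset.single_le_sum (f := fun i => ((r i).map Prod.fst).getD 0) (fun _ _ => Nat.zero_le _) hi
  rcases hr : r i with _ | ⟨n, σ⟩
  · simp [weight]
  · simp only [hr, Option.map_some, Option.getD_some] at hle
    simp only [weight, Option.map_some, Option.getD_some, Option.elim, Nat.cast_pow,
      Nat.cast_ofNat]
    rw [div_eq_iff (by positivity), one_div, inv_pow]
    have h : reqExp r t + 1 = (reqExp r t + 1 - n) + n := by omega
    have h2 : (2 : ℝ) * 2 ^ reqExp r t = 2 ^ (reqExp r t + 1 - n) * 2 ^ n := by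
      rw [← pow_add, ← h, pow_succ, mul_comm]
    field_simp
    linarith

theorem reqVal_bounds (r : ℕ → Option (ℕ × List Bool)) {t n : ℕ} {σ : List Bool}
    (h : r t = some (n, σ)) :
    2 * ∑ i ∈ Finset.range t, weight (r i) < (reqVal r t n : ℝ) / 2 ^ n ∧
      ((reqVal r t n : ℝ) + 1) / 2 ^ n ≤ 2 * ∑ i ∈ Finset.range (t + 1), weight (r i) := by
  have hw : weight (r t) = 1 / 2 ^ n := by simp [h, weight]
  rw [Finset.sum_range_succ, hw, mul_add, ← reqNum_eq, reqVal]
  set P := reqNum r t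
  set S := reqExp r t
  have h1 : 2 ^ n * P / 2 ^ S * 2 ^ S ≤ 2 ^ n * P := Nat.div_mul_le_self _ _
  have h2 : 2 ^ n * P < (2 ^ n * P / 2 ^ S + 1) * 2 ^ S := by
    rw [mul_comm _ (2 ^ S)]; exact Nat.lt_mul_div_succ _ (Nat.two_pow_pos S)
  have h1' : ((2 ^ n * P / 2 ^ S : ℕ) : ℝ) * 2 ^ S ≤ 2 ^ n * P := by exact_mod_cast h1
  have h2' : (2 : ℝ) ^ n * P < (((2 ^ n * P / 2 ^ S : ℕ) : ℝ) + 1) * 2 ^ S := by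
    exact_mod_cast h2
  push_cast at h1' h2' ⊢
  constructor
  · rw [div_lt_div_iff₀ (by positivity) (by positivity)]
    linarith
  · rw [div_add' _ _ _ (by positivity), div_le_div_iff₀ (by positivity) (by positivity)]
    have hn : (0 : ℝ) < 2 ^ n := by positivity
    field_simp
    nlinarith

theorem computable_reqVal {r : ℕ → Option (ℕ × List Bool)} (hr : Computable r) :
    Computable₂ (reqVal r) := by
  have hS : Computable (reqExp r) := by
    have h : Computable fun i => ((r i).map Prod.fst).getD 0 :=
      Computable.option_getD (Computable.option_map hr (Computable.fst.comp Computable.snd).to₂)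
        (Computable.const 0)
    exact computable_sum_range (h.comp Computable.snd).to₂ Computable.id
  have hP : Computable (reqNum r) := by
    have h : Computable₂ fun (y : ℕ × ℕ) (x : ℕ × List Bool) =>
        2 ^ (reqExp r y.1 + 1 - x.1) := by
      refine Computable₂.mk (computable_pow (Computable.const 2) ?_)
      refine computable_sub (computable_add ?_ (Computable.const 1)) ?_
      · exact hS.comp (Computable.fst.comp Computable.fst)
      · exact Computable.fst.comp Computable.snd
    have h' : Computable fun y : ℕ × ℕ =>
        ((r y.2).map fun x => 2 ^ (reqExp r y.1 + 1 - x.1)).getD 0 :=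
      Computable.option_getD (Computable.option_map (hr.comp Computable.snd) h)
        (Computable.const 0)
    exact computable_sum_range h'.to₂ Computable.id
  refine computable_add (computable_div (computable_mul ?_ ?_) ?_) (Computable.const 1)
  · exact computable_pow (Computable.const 2) Computable.snd
  · exact hP.comp Computable.fst
  · exact computable_pow (Computable.const 2) (hS.comp Computable.fst)

/-- The output of request `t`, if `p` is the program allotted to it. -/
def reqMatch (r : ℕ → Option (ℕ × List Bool)) (p : List Bool) (t : ℕ) : Option (List Bool) :=
  (r t).bind fun x =>
    if (decide (p.length = x.1) && decide (val p = reqVal r t x.1)) = true then some x.2 else none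

theorem reqMatch_eq_some {r : ℕ → Option (ℕ × List Bool)} {p σ : List Bool} {t : ℕ} :
    reqMatch r p t = some σ ↔ r t = some (p.length, σ) ∧ val p = reqVal r t p.length := by
  simp only [reqMatch, Option.bind_eq_some_iff, Bool.and_eq_true, decide_eq_true_eq,
    Option.ite_none_right_eq_some, Option.some.injEq, Prod.exists]
  constructor
  · rintro ⟨n, τ, h1, ⟨rfl, h2⟩, rfl⟩
    exact ⟨h1, h2⟩
  · rintro ⟨h1, h2⟩
    exact ⟨_, _, h1, ⟨rfl, h2⟩, rfl⟩

theorem computable_reqMatch {r : ℕ → Option (ℕ × List Bool)} (hr : Computable r) :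
    Computable₂ (reqMatch r) := by
  refine Computable.option_bind (hr.comp Computable.snd) (Computable₂.mk ?_)
  refine computable_ite (computable_and (computable_decide_eq ?_ ?_) (computable_decide_eq ?_ ?_))
    ?_ (Computable.const none)
  · exact Primrec.list_length.to_comp.comp (Computable.fst.comp Computable.fst)
  · exact Computable.fst.comp Computable.snd
  · exact computable_val.comp (Computable.fst.comp Computable.fst)
  · exact (computable_reqVal hr).comp (Computable.snd.comp Computable.fst)
      (Computable.fst.comp Computable.snd)
  · exact Computable.option_some.comp (Computable.snd.comp Computable.snd)

theorem not_prefix_of_reqMatch {r : ℕ → Option (ℕ × List Bool)} {p q σ τ : List Bool} {t u : ℕ}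
    (htu : t < u) (hp : reqMatch r p t = some σ) (hq : reqMatch r q u = some τ) :
    ¬ p <+: q ∧ ¬ q <+: p := by
  rw [reqMatch_eq_some] at hp hq
  have h1 := reqVal_bounds r hp.1
  have h2 := reqVal_bounds r hq.1
  rw [← hp.2] at h1
  rw [← hq.2] at h2
  have hmono : ∑ i ∈ Finset.range (t + 1), weight (r i) ≤ ∑ i ∈ Finset.range u, weight (r i) :=
    Finset.sum_le_sum_of_subset_of_nonneg (Finset.range_subset_range.2 htu)
      fun i _ _ => weight_nonneg _
  have hpos : (val p : ℝ) / 2 ^ p.length < (val p + 1) / 2 ^ p.length := by gcongr; linarith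
  have hpos' : (val q : ℝ) / 2 ^ q.length < (val q + 1) / 2 ^ q.length := by gcongr; linarith
  constructor <;> intro h <;> have := prefix_val h <;> linarith

/-- The Kraft–Chaitin theorem, up to one bit: a computable list of requests of total weight at most
`1/2` is met by a prefix-free machine. The request of weight `2^(-n)` takes up an interval of
length `2 * 2^(-n)`, which contains a dyadic interval of length `2^(-n)`. -/
theorem exists_machine {r : ℕ → Option (ℕ × List Bool)} (hr : Computable r)
    (hw : ∀ T, ∑ t ∈ Finset.range T, weight (r t) ≤ 1 / 2) :
    ∃ M, IsPrefixMachine M ∧ ∀ t n σ, r t = some (n, σ) → complexity M σ ≤ n := by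
  have hex : ∀ {p}, (Nat.rfindOpt (reqMatch r p)).Dom → ∃ t σ, reqMatch r p t = some σ :=
    fun h => Nat.rfindOpt_dom.1 h
  refine ⟨fun p => Nat.rfindOpt (reqMatch r p), ⟨?_, ?_⟩, ?_⟩
  · exact Partrec.rfindOpt (computable_reqMatch hr)
  · intro p q hp hq h
    obtain ⟨t, σ, ht⟩ := hex hp
    obtain ⟨u, τ, hu⟩ := hex hq
    rcases lt_trichotomy t u with htu | rfl | htu
    · exact absurd h (not_prefix_of_reqMatch htu ht hu).1
    · rw [reqMatch_eq_some] at ht hu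
      have := ht.1.symm.trans hu.1
      exact h.eq_of_length (by simp at this; exact this.1)
    · exact absurd h (not_prefix_of_reqMatch htu hu ht).2
  · intro t n σ h
    have hlt : reqVal r t n < 2 ^ n := by
      have h1 := (reqVal_bounds r h).2.trans (mul_le_mul_of_nonneg_left (hw _) zero_le_two)
      rw [div_le_iff₀ (by positivity)] at h1
      have : (reqVal r t n : ℝ) + 1 ≤ 2 ^ n := by linarith
      exact_mod_cast this
    obtain ⟨p, hp, hv⟩ := exists_val n _ hlt
    subst hp
    have ht : reqMatch r p t = some σ := reqMatch_eq_some.2 ⟨h, hv⟩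
    refine complexity_le (Part.eq_some_iff.1 ?_)
    have hd : (Nat.rfindOpt (reqMatch r p)).Dom := Nat.rfindOpt_dom.2 ⟨t, σ, ht⟩
    obtain ⟨τ, hτ⟩ := Part.dom_iff_mem.1 hd
    obtain ⟨u, hu⟩ := Nat.rfindOpt_spec hτ
    have htu : t = u := by
      rcases lt_trichotomy t u with htu | htu | htu
      · exact absurd List.prefix_rfl (not_prefix_of_reqMatch htu ht hu).1
      · exact htu
      · exact absurd List.prefix_rfl (not_prefix_of_reqMatch htu hu ht).1
    subst htu
    rw [Option.mem_def, ht, Option.some.injEq] at hu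
    exact Part.eq_some_iff.2 (hu ▸ hτ)

/-! ### Martin-Löf random sequences defeat recursive martingales -/

theorem IsMartingale.le_two_pow {M : List Bool → ℝ} (hM : IsMartingale M) (σ : List Bool) :
    M σ ≤ 2 ^ σ.length * M [] := by
  induction σ using List.reverseRecOn with
  | nil => simp
  | append_singleton σ b ih =>
    have h1 := hM.1 (σ ++ [false])
    have h2 := hM.1 (σ ++ [true])
    have h3 := hM.2 σ
    have : M (σ ++ [b]) ≤ 2 * M σ := by cases b <;> linarith
    rw [List.length_append, List.length_singleton, pow_succ]
    linarith

/-- The number of proper prefixes of `σ` at which `f` is at least `B`. -/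
def earlier (f : List Bool → ℕ) (B : ℕ) (σ : List Bool) : ℕ :=
  ∑ i ∈ Finset.range σ.length, if decide (B ≤ f (σ.take i)) = true then 1 else 0

/-- Whether `σ` is a minimal string at which `f` is at least `B`. -/
def crosses (f : List Bool → ℕ) (B : ℕ) (σ : List Bool) : Bool :=
  decide (B ≤ f σ) && decide (earlier f B σ = 0)

theorem crosses_iff {f : List Bool → ℕ} {B : ℕ} {σ : List Bool} :
    crosses f B σ = true ↔ B ≤ f σ ∧ ∀ i < σ.length, ¬ B ≤ f (σ.take i) := by
  simp [crosses, earlier]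

theorem computable_crosses {f : List Bool → ℕ} (hf : Computable f) : Computable₂ (crosses f) := by
  have hterm : Computable fun y : (ℕ × List Bool) × ℕ =>
      if decide (y.1.1 ≤ f (y.1.2.take y.2)) = true then 1 else 0 := by
    refine computable_ite (computable_decide_le (Computable.fst.comp Computable.fst)
      (hf.comp ?_)) (Computable.const 1) (Computable.const 0)
    exact Primrec.list_take.to_comp.comp Computable.snd (Computable.snd.comp Computable.fst)
  have hlen : Computable fun y : ℕ × List Bool => y.2.length :=
    Primrec.list_length.to_comp.comp Computable.snd
  have hcnt : Computable fun y : ℕ × List Bool => earlier f y.1 y.2 :=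
    computable_sum_range (f := fun (y : ℕ × List Bool) i =>
      if decide (y.1 ≤ f (y.2.take i)) = true then 1 else 0) hterm.to₂ hlen
  exact computable_and (computable_decide_le Computable.fst (hf.comp Computable.snd))
    (computable_decide_eq hcnt (Computable.const 0))

theorem prefixFree_crosses (f : List Bool → ℕ) (B : ℕ) :
    PrefixFree {σ | crosses f B σ = true} := by
  intro p hp q hq h
  by_contra hne
  have hlen : p.length < q.length :=
    lt_of_le_of_ne h.length_le fun he => hne (h.eq_of_length he)
  refine (crosses_iff.1 hq).2 p.length hlen ?_
  rw [← List.prefix_iff_eq_take.1 h]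
  exact (crosses_iff.1 hp).1

/-- Request number `⟨c, i⟩` asks for a program of length `|σ| - c` for the `i`-th string `σ`,
provided `σ` is minimal with `f σ > C * 4 ^ c`. Not every number is the code of a string: the
first condition lets each string in once. -/
def savings (f : List Bool → ℕ) (C t : ℕ) : Option (ℕ × List Bool) :=
  if (decide (Encodable.encode (str t.unpair.2) = t.unpair.2) &&
      crosses f (C * 4 ^ t.unpair.1 + 1) (str t.unpair.2)) = true then
    some ((str t.unpair.2).length - t.unpair.1, str t.unpair.2) else none

theorem computable_savings {f : List Bool → ℕ} (hf : Computable f) (C : ℕ) :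
    Computable (savings f C) := by
  have h1 : Computable fun t : ℕ => t.unpair.1 := Computable.fst.comp Computable.unpair
  have h2 : Computable fun t : ℕ => t.unpair.2 := Computable.snd.comp Computable.unpair
  have h3 : Computable fun t : ℕ => str t.unpair.2 := primrec_str.to_comp.comp h2
  have h4 : Computable fun t : ℕ => (str t.unpair.2).length := Primrec.list_length.to_comp.comp h3
  have h5 : Computable fun t : ℕ => C * 4 ^ t.unpair.1 + 1 := by
    refine computable_add (computable_mul (Computable.const C) ?_) (Computable.const 1)
    exact computable_pow (Computable.const 4) h1
  refine computable_ite (computable_and (computable_decide_eq (Computable.encode.comp h3) h2)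
    ((computable_crosses hf).comp h5 h3)) ?_ (Computable.const none)
  exact Computable.option_some.comp ((computable_sub h4 h1).pair h3)

theorem MLRandomSeq.computablyRandomSeq {X : ℕ → Bool} (hX : MLRandomSeq X) :
    ComputablyRandomSeq X := by
  rintro ⟨M, hM, ⟨a, ha, hMa⟩, hs⟩
  have hle : ∀ σ, (a σ 0 : ℝ) - 1 ≤ M σ ∧ M σ ≤ a σ 0 + 1 := fun σ => by
    have := abs_le.1 (hMa σ 0)
    simp only [pow_zero, div_one] at this
    constructor <;> linarith
  obtain ⟨C, hC⟩ := exists_nat_ge (4 * (M [] + 1))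
  have hM0 := hM.1 []
  have hCpos : (0 : ℝ) < C := by linarith
  let good : ℕ → List Bool → Bool := fun c σ => crosses (fun σ => a σ 0) (C * 4 ^ c + 1) σ
  have hgoodM : ∀ c σ, good c σ = true → (C : ℝ) * 4 ^ c ≤ M σ := by
    intro c σ h
    have h1 : ((C : ℝ) * 4 ^ c + 1) ≤ a σ 0 := by exact_mod_cast (crosses_iff.1 h).1
    linarith [(hle σ).1]
  set r := savings (fun σ => a σ 0) C with hrdef
  have hr : Computable r :=
    computable_savings (ha.comp Computable.id (Computable.const 0)) C
  -- For fixed `c` the weight is at most `2 ^ (-c) / 4`, by Ville's inequality.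
  have hcol : ∀ (c T : ℕ), ∑ i ∈ Finset.range T, weight (r (Nat.pair c i)) ≤ (1 / 2) ^ c / 4 := by
    intro c T
    let I : Finset ℕ := (Finset.range T).filter fun i => Encodable.encode (str i) = i
    have hinj : Set.InjOn str I := fun i hi j hj hij => by
      rw [← (Finset.mem_filter.1 hi).2, hij, (Finset.mem_filter.1 hj).2]
    let F : Finset (List Bool) := (I.image str).filter fun σ => good c σ = true
    have h1 : ∑ i ∈ Finset.range T, weight (r (Nat.pair c i))
        = ∑ σ ∈ F, (1 / 2 : ℝ) ^ (σ.length - c) := by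
      rw [Finset.sum_filter, Finset.sum_image hinj, Finset.sum_filter]
      refine Finset.sum_congr rfl fun i _ => ?_
      simp only [hrdef, savings, Nat.unpair_pair, Bool.and_eq_true, decide_eq_true_eq]
      by_cases h1 : Encodable.encode (str i) = i <;> by_cases h2 : good c (str i) = true <;>
        simp [h1, h2, good, weight] at *
    have h2 : ∀ σ ∈ F, (1 / 2 : ℝ) ^ (σ.length - c)
        ≤ (M σ / 2 ^ σ.length) * ((1 / 2) ^ c / C) := by
      intro σ h
      have h3 := hgoodM c σ (Finset.mem_filter.1 h).2
      have h4 : (2 : ℝ) ^ σ.length ≤ 2 ^ (σ.length - c) * 2 ^ c := by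
        rw [← pow_add]
        exact pow_le_pow_right₀ one_le_two (by omega)
      have h5 : (4 : ℝ) ^ c = 2 ^ c * 2 ^ c := by rw [← mul_pow]; norm_num
      rw [one_div, inv_pow, inv_pow, ← one_div, div_le_iff₀ (by positivity)]
      have h6 : M σ / 2 ^ σ.length * ((2 ^ c)⁻¹ / C) * 2 ^ (σ.length - c)
          = (M σ * 2 ^ (σ.length - c)) / (2 ^ σ.length * 2 ^ c * C) := by
        field_simp
      rw [h6, le_div_iff₀ (by positivity), one_mul]
      calc (2 : ℝ) ^ σ.length * 2 ^ c * C ≤ 2 ^ (σ.length - c) * 2 ^ c * 2 ^ c * C := by gcongr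
        _ = (C * 4 ^ c) * 2 ^ (σ.length - c) := by rw [h5]; ring
        _ ≤ M σ * 2 ^ (σ.length - c) := by gcongr
    rw [h1]
    refine (Finset.sum_le_sum h2).trans ?_
    rw [← Finset.sum_mul]
    have h7 := hM.sum_le F fun p hp q hq h => prefixFree_crosses _ _ p
      (Finset.mem_filter.1 (Finset.mem_coe.1 hp)).2 q
      (Finset.mem_filter.1 (Finset.mem_coe.1 hq)).2 h
    have h8 : M [] * ((1 / 2) ^ c / C) ≤ (1 / 2) ^ c / 4 := by
      rw [mul_div_assoc', div_le_div_iff₀ hCpos (by norm_num)]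
      have : (0 : ℝ) < (1 / 2) ^ c := by positivity
      nlinarith
    exact (mul_le_mul_of_nonneg_right h7 (by positivity)).trans h8
  have hw : ∀ T, ∑ t ∈ Finset.range T, weight (r t) ≤ 1 / 2 := by
    intro T
    have h1 : ∑ t ∈ Finset.range T, weight (r t)
        ≤ ∑ x ∈ Finset.range T ×ˢ Finset.range T, weight (r (Nat.pair x.1 x.2)) := by
      have h2 : ∑ t ∈ Finset.range T, weight (r t)
          = ∑ x ∈ (Finset.range T).image Nat.unpair, weight (r (Nat.pair x.1 x.2)) := by
        rw [Finset.sum_image fun x _ y _ h => by rw [← Nat.pair_unpair x, h, Nat.pair_unpair]]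
        simp
      rw [h2]
      refine Finset.sum_le_sum_of_subset_of_nonneg ?_ fun _ _ _ => weight_nonneg _
      intro x hx
      obtain ⟨t, ht, rfl⟩ := Finset.mem_image.1 hx
      rw [Finset.mem_range] at ht
      exact Finset.mem_product.2 ⟨Finset.mem_range.2 ((Nat.unpair_left_le t).trans_lt ht),
        Finset.mem_range.2 ((Nat.unpair_right_le t).trans_lt ht)⟩
    rw [Finset.sum_product] at h1
    refine h1.trans ((Finset.sum_le_sum fun c _ => hcol c T).trans ?_)
    rw [← Finset.sum_div]
    have := sum_geometric_two_le T
    linarith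
  obtain ⟨N, hN, hNc⟩ := exists_machine hr hw
  obtain ⟨k, hk⟩ := isUniversalMachine_U.2 N hN
  obtain ⟨d, hd⟩ := hX
  set c := k + d + 1
  -- The first prefix at which the capital reaches `C * 4 ^ c` saves `c` bits, more than `k + d`.
  have hex : ∃ n, C * 4 ^ c + 1 ≤ a (pre X n) 0 := by
    obtain ⟨n, hn⟩ := (hs (C * 4 ^ c + 2)).exists
    refine ⟨n, ?_⟩
    have : ((C : ℝ) * 4 ^ c + 1) ≤ a (pre X n) 0 := by linarith [(hle (pre X n)).2]
    exact_mod_cast this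
  classical
  set n := Nat.find hex
  have hg : good c (pre X n) = true := by
    refine crosses_iff.2 ⟨Nat.find_spec hex, fun i hi => ?_⟩
    rw [length_pre] at hi
    have : (pre X n).take i = pre X i := by
      rw [← Nat.add_sub_of_le hi.le, pre_add, List.take_left' (length_pre X i)]
    rw [this]
    exact Nat.find_min hex hi
  have hcn : c ≤ n := by
    have h1 := (hgoodM _ _ hg).trans (hM.le_two_pow _)
    rw [length_pre] at h1
    have h2 : (C : ℝ) * 4 ^ c ≤ C * 2 ^ n := by
      have : (0 : ℝ) < 2 ^ n := by positivity
      nlinarith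
    have h3 : (4 : ℝ) ^ c ≤ 2 ^ n := le_of_mul_le_mul_left h2 hCpos
    have h4 : (2 : ℝ) ^ c ≤ 4 ^ c := by gcongr; norm_num
    exact (pow_le_pow_iff_right₀ one_lt_two).1 (h4.trans h3)
  have hreq : r (Nat.pair c (Encodable.encode (pre X n))) = some (n - c, pre X n) := by
    simp only [good] at hg
    simp [hrdef, savings, str_encode, hg, length_pre]
  have h1 := (hk (pre X n)).trans (add_le_add_left (hNc _ _ _ hreq) (k : ℕ∞))
  have h2 := (hd n).trans (add_le_add_left h1 (d : ℕ∞))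
  have h3 : n ≤ n - c + k + d := by exact_mod_cast h2
  omega

theorem ComputablyRandomSeq.schnorrRandomSeq {X : ℕ → Bool} (hX : ComputablyRandomSeq X) :
    SchnorrRandomSeq X :=
  fun ⟨M, hM, hr, hs⟩ => hX ⟨M, hM, hr, hs.1⟩

theorem MLRandom.computablyRandom {r : ℝ} : MLRandom r → ComputablyRandom r :=
  fun ⟨X, hX, h⟩ => ⟨X, hX, h.computablyRandomSeq⟩

theorem ComputablyRandom.schnorrRandom {r : ℝ} : ComputablyRandom r → SchnorrRandom r :=
  fun ⟨X, hX, h⟩ => ⟨X, hX, h.schnorrRandomSeq⟩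

/-! ### Martin-Löf randomness depends only on a tail -/

theorem MLRandomSeq.of_tail {X Y : ℕ → Bool} (hX : MLRandomSeq X) (a b : ℕ)
    (h : ∀ n, Y (a + n) = X (b + n)) : MLRandomSeq Y := by
  have hf : Computable fun σ : List Bool => pre X b ++ σ.drop a :=
    Computable.list_append.comp (Computable.const (pre X b))
      (Primrec.list_drop.to_comp.comp (Computable.const a) Computable.id)
  obtain ⟨c, hc⟩ := exists_K_le_of_partrec hf.partrec
  obtain ⟨d, hd⟩ := hX
  refine ⟨a + c + d, fun m => ?_⟩
  rcases le_total m a with hm | hm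
  · exact (Nat.cast_le.2 hm).trans (le_add_left (by push_cast; rw [add_assoc]; exact le_self_add))
  · obtain ⟨n, rfl⟩ := Nat.exists_eq_add_of_le hm
    have h1 : pre X (b + n) = pre X b ++ (pre Y (a + n)).drop a := by
      rw [pre_add, pre_add, List.drop_left' (length_pre Y a)]
      simp only [h]
    have h2 := hc (pre Y (a + n)) (pre X (b + n)) (by rw [h1]; exact Part.mem_some _)
    have h3 := (hd (b + n)).trans (add_le_add_left h2 (d : ℕ∞))
    calc ((a + n : ℕ) : ℕ∞) ≤ ((b + n : ℕ) : ℕ∞) + a := by norm_cast; omega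
      _ ≤ K (pre Y (a + n)) + c + d + a := by gcongr
      _ = _ := by push_cast; ring

/-! ### The halting probability -/

theorem eventually_eq_sSup {f : ℕ → ℕ} {B : ℕ} (hf : Monotone f) (hB : ∀ s, f s ≤ B) :
    ∀ᶠ s in atTop, f s = sSup (Set.range f) := by
  have hb : BddAbove (Set.range f) := ⟨B, by rintro _ ⟨s, rfl⟩; exact hB s⟩
  obtain ⟨s₀, hs₀⟩ := Nat.sSup_mem (Set.range_nonempty f) hb
  filter_upwards [eventually_ge_atTop s₀] with s hs
  exact le_antisymm (le_csSup hb ⟨s, rfl⟩) (hs₀ ▸ hf hs)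

theorem monotone_div_pow {W : ℕ → ℕ} (hW : ∀ s, 2 * W s ≤ W (s + 1)) (n : ℕ) :
    Monotone fun s => W (s + n) / 2 ^ s := by
  refine monotone_nat_of_le_succ fun s => ?_
  have h : W (s + n) / 2 ^ s = 2 * W (s + n) / 2 ^ (s + 1) := by
    rw [pow_succ', Nat.mul_div_mul_left _ _ two_pos]
  rw [h, add_right_comm]
  exact Nat.div_le_div_right (hW _)

/-- The binary digits of a nondecreasing sequence of dyadic rationals in `[0, 1)` converge. -/
theorem exists_limit_digits {W : ℕ → ℕ} (hW : ∀ s, 2 * W s ≤ W (s + 1)) (hb : ∀ s, W s < 2 ^ s) :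
    ∃ X : ℕ → Bool, ∀ n, ∀ᶠ s in atTop, W s / 2 ^ (s - n) = val (pre X n) := by
  let V : ℕ → ℕ := fun n => sSup (Set.range fun s => W (s + n) / 2 ^ s)
  have hV : ∀ n, ∀ᶠ s in atTop, W s / 2 ^ (s - n) = V n := by
    intro n
    have h := eventually_eq_sSup (B := 2 ^ n) (monotone_div_pow hW n) fun s =>
      (Nat.div_lt_of_lt_mul (by rw [← pow_add]; exact hb _)).le
    have h' := (tendsto_sub_atTop_nat n).eventually h
    filter_upwards [h', eventually_ge_atTop n] with s hs hn
    rwa [Nat.sub_add_cancel hn] at hs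
  refine ⟨fun n => decide (V (n + 1) % 2 = 1), fun n => ?_⟩
  have hval : V n = val (pre (fun n => decide (V (n + 1) % 2 = 1)) n) := by
    induction n with
    | zero =>
      obtain ⟨s, hs⟩ := (hV 0).exists
      rw [← hs, Nat.sub_zero, Nat.div_eq_of_lt (hb s)]
      rfl
    | succ n ih =>
      rw [pre_succ, val_append_singleton, ← ih]
      obtain ⟨s, ⟨h1, h2⟩, h3⟩ := (((hV n).and (hV (n + 1))).and (eventually_gt_atTop n)).exists
      have h4 : V n = V (n + 1) / 2 := by
        rw [← h1, ← h2, Nat.div_div_eq_div_mul, ← pow_succ]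
        congr 2
        omega
      rcases Nat.mod_two_eq_zero_or_one (V (n + 1)) with h | h <;> simp [h] <;> omega
  rw [← hval]
  exact hV n

/-- Whether, within `s` steps, the program `c` is seen to halt on the code `i` of a string. -/
def halted (c : Code) (s i : ℕ) : Bool :=
  (Code.evaln s c i).isSome && (decide (Encodable.encode (str i) = i) &&
    decide ((str i).length + 1 ≤ s))

theorem halted_iff {c : Code} {s i : ℕ} : halted c s i = true ↔
    (∃ v, v ∈ Code.evaln s c i) ∧ Encodable.encode (str i) = i ∧ (str i).length + 1 ≤ s := by
  simp [halted, Option.isSome_iff_exists]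

theorem halted_mono {c : Code} {s t i : ℕ} (hst : s ≤ t) (h : halted c s i = true) :
    halted c t i = true := by
  rw [halted_iff] at h ⊢
  obtain ⟨⟨v, hv⟩, h1, h2⟩ := h
  exact ⟨⟨v, Code.evaln_mono hst hv⟩, h1, h2.trans hst⟩

/-- The numerator, over `2 ^ s`, of half the weight of the strings on which `c` is seen to halt
within `s` steps. (Halving keeps the weights below `1`.) -/
def haltNum (c : Code) (s : ℕ) : ℕ :=
  ∑ i ∈ Finset.range s, if halted c s i = true then 2 ^ (s - ((str i).length + 1)) else 0

theorem computable_haltNum (c : Code) : Computable (haltNum c) := by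
  have h3 : Computable fun y : ℕ × ℕ => str y.2 := primrec_str.to_comp.comp Computable.snd
  have h4 : Computable fun y : ℕ × ℕ => (str y.2).length + 1 :=
    computable_add (Primrec.list_length.to_comp.comp h3) (Computable.const 1)
  have h5 : Computable fun y : ℕ × ℕ => (Code.evaln y.1 c y.2).isSome :=
    Primrec.option_isSome.to_comp.comp (Code.primrec_evaln.to_comp.comp
      ((Computable.fst.pair (Computable.const c)).pair Computable.snd))
  have h6 : Computable fun y : ℕ × ℕ => halted c y.1 y.2 :=
    computable_and h5 (computable_and (computable_decide_eq (Computable.encode.comp h3)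
      Computable.snd) (computable_decide_le h4 Computable.fst))
  have h7 : Computable fun y : ℕ × ℕ =>
      if halted c y.1 y.2 = true then 2 ^ (y.1 - ((str y.2).length + 1)) else 0 :=
    computable_ite h6 (computable_pow (Computable.const 2) (computable_sub Computable.fst h4))
      (Computable.const 0)
  exact computable_sum_range (f := fun s i =>
    if halted c s i = true then 2 ^ (s - ((str i).length + 1)) else 0) h7.to₂ Computable.id

theorem haltNum_mul_eq (c : Code) {s t : ℕ} (hst : s ≤ t) :
    haltNum c s * 2 ^ (t - s) = ∑ i ∈ Finset.range t,
      if halted c s i = true then 2 ^ (t - ((str i).length + 1)) else 0 := by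
  rw [haltNum, Finset.sum_mul]
  rw [← Finset.sum_subset (Finset.range_subset_range.2 hst)]
  · refine Finset.sum_congr rfl fun i _ => ?_
    split
    · rename_i h
      have := (halted_iff.1 h).2.2
      rw [← pow_add]
      congr 1
      omega
    · simp
  · intro i _ hi
    rw [if_neg]
    intro h
    obtain ⟨v, hv⟩ := (halted_iff.1 h).1
    exact hi (Finset.mem_range.2 (Code.evaln_bound hv))

theorem two_mul_haltNum_le (c : Code) (s : ℕ) : 2 * haltNum c s ≤ haltNum c (s + 1) := by
  have h := haltNum_mul_eq c (Nat.le_succ s)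
  rw [Nat.succ_eq_add_one, Nat.add_sub_cancel_left, pow_one, mul_comm] at h
  rw [h]
  refine Finset.sum_le_sum fun i _ => ?_
  split
  · rename_i h
    rw [if_pos (halted_mono (Nat.le_succ s) h)]
  · exact Nat.zero_le _

/-- A halting computation that has not been seen by stage `s` adds its weight later. -/
theorem haltNum_jump (c : Code) {s t i : ℕ} (hst : s ≤ t) (hs : ¬ halted c s i = true)
    (ht : halted c t i = true) :
    haltNum c s * 2 ^ (t - s) + 2 ^ (t - ((str i).length + 1)) ≤ haltNum c t := by
  obtain ⟨v, hv⟩ := (halted_iff.1 ht).1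
  have hi : i ∈ Finset.range t := Finset.mem_range.2 (Code.evaln_bound hv)
  rw [haltNum_mul_eq c hst, haltNum, ← Finset.add_sum_erase _ _ hi, ← Finset.add_sum_erase _ _ hi,
    if_neg hs, if_pos ht, zero_add, add_comm]
  refine Nat.add_le_add_left (Finset.sum_le_sum fun j _ => ?_) _
  split
  · rename_i h
    rw [if_pos (halted_mono hst h)]
  · exact Nat.zero_le _

/-- `c` is a program for the universal machine, acting on codes of strings. -/
def IsCodeU (c : Code) : Prop :=
  c.eval = fun n => Part.bind (Encodable.decode (α := List Bool) n)
    fun a => (U a).map Encodable.encode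

theorem exists_isCodeU : ∃ c, IsCodeU c := Code.exists_code.1 isUniversalMachine_U.1.1

theorem IsCodeU.mem_of_mem_evaln {c : Code} (hc : IsCodeU c) {s i v : ℕ}
    (h : v ∈ Code.evaln s c i) : ∃ τ ∈ U (str i), v = Encodable.encode τ := by
  have h1 := Code.evaln_sound h
  rw [hc] at h1
  simp only [Part.mem_bind_iff, Part.mem_map_iff, Part.mem_ofOption, Option.mem_def] at h1
  obtain ⟨a, ha, τ, hτ, hv⟩ := h1
  refine ⟨τ, ?_, hv.symm⟩
  rwa [str, ha]

theorem IsCodeU.haltNum_lt {c : Code} (hc : IsCodeU c) (s : ℕ) : haltNum c s < 2 ^ s := by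
  let I : Finset ℕ := (Finset.range s).filter fun i => halted c s i = true
  have hI : ∀ i ∈ I, halted c s i = true := fun i hi => (Finset.mem_filter.1 hi).2
  have hinj : Set.InjOn str I := fun i hi j hj hij => by
    rw [← (halted_iff.1 (hI i hi)).2.1, hij, (halted_iff.1 (hI j hj)).2.1]
  have hdom : ∀ i ∈ I, (U (str i)).Dom := fun i hi => by
    obtain ⟨v, hv⟩ := (halted_iff.1 (hI i hi)).1
    obtain ⟨τ, hτ, -⟩ := hc.mem_of_mem_evaln hv
    exact Part.dom_iff_mem.2 ⟨τ, hτ⟩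
  have hk := kraft (I.image str) <| by
    intro p hp q hq h
    obtain ⟨i, hi, rfl⟩ := Finset.mem_image.1 (Finset.mem_coe.1 hp)
    obtain ⟨j, hj, rfl⟩ := Finset.mem_image.1 (Finset.mem_coe.1 hq)
    exact isUniversalMachine_U.1.2 _ _ (hdom i hi) (hdom j hj) h
  rw [Finset.sum_image hinj] at hk
  have h1 : (haltNum c s : ℝ) = 2 ^ s / 2 * ∑ i ∈ I, (1 : ℝ) / 2 ^ (str i).length := by
    rw [haltNum, ← Finset.sum_filter, Nat.cast_sum, Finset.mul_sum]
    refine Finset.sum_congr rfl fun i hi => ?_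
    have h2 := (halted_iff.1 (hI i hi)).2.2
    obtain ⟨k, hk⟩ := Nat.exists_eq_add_of_le h2
    rw [hk]
    push_cast
    rw [Nat.add_sub_cancel_left, pow_add, pow_succ]
    field_simp
  have h2 : (0 : ℝ) < 2 ^ s := by positivity
  have h3 : (haltNum c s : ℝ) < 2 ^ s := by rw [h1]; nlinarith
  exact_mod_cast h3

/-- A number exceeding the length of every output of `c` seen by stage `s`. -/
def outBound (c : Code) (s : ℕ) : ℕ :=
  ∑ i ∈ Finset.range s, ((Code.evaln s c i).map fun v => (str v).length).getD 0 + 1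

theorem computable_outBound (c : Code) : Computable (outBound c) := by
  have h1 : Computable fun y : ℕ × ℕ => Code.evaln y.1 c y.2 :=
    Code.primrec_evaln.to_comp.comp ((Computable.fst.pair (Computable.const c)).pair Computable.snd)
  have h2 : Computable fun y : ℕ × ℕ =>
      ((Code.evaln y.1 c y.2).map fun v => (str v).length).getD 0 :=
    Computable.option_getD (Computable.option_map h1
      (Primrec.list_length.to_comp.comp (primrec_str.to_comp.comp Computable.snd)).to₂)
      (Computable.const 0)
  exact computable_add (computable_sum_range (f := fun s i =>
    ((Code.evaln s c i).map fun v => (str v).length).getD 0) h2.to₂ Computable.id)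
    (Computable.const 1)

theorem length_lt_outBound {c : Code} {s i v : ℕ} (h : v ∈ Code.evaln s c i) :
    (str v).length < outBound c s := by
  have h1 := Finset.single_le_sum
    (f := fun i => ((Code.evaln s c i).map fun v => (str v).length).getD 0)
    (fun _ _ => Nat.zero_le _) (Finset.mem_range.2 (Code.evaln_bound h))
  rw [Option.mem_def] at h
  simp only [h, Option.map_some, Option.getD_some] at h1
  exact Nat.lt_succ_of_le h1

/-- Chaitin's theorem: the halting probability is Martin-Löf random. Its first `n` digits determine
a stage by which all programs of length less than `n` that ever halt have halted, hence a string
without such a program. -/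
theorem IsCodeU.mlRandomSeq {c : Code} (hc : IsCodeU c) {X : ℕ → Bool}
    (hX : ∀ n, ∀ᶠ s in atTop, haltNum c s / 2 ^ (s - n) = val (pre X n)) : MLRandomSeq X := by
  let f : List Bool →. List Bool := fun σ => Nat.rfindOpt fun s =>
    if decide (val σ * 2 ^ s ≤ haltNum c s * 2 ^ σ.length) = true then
      some ((List.range (outBound c s)).map fun _ => false) else none
  have hf : Partrec f := by
    have hl : Computable fun y : List Bool × ℕ =>
        (List.range (outBound c y.2)).map fun _ => false :=
      (Primrec.list_map Primrec.list_range (Primrec.const false).to₂).to_comp.comp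
        ((computable_outBound c).comp Computable.snd)
    have hlen : Computable fun y : List Bool × ℕ => y.1.length :=
      Primrec.list_length.to_comp.comp Computable.fst
    have hcond : Computable fun y : List Bool × ℕ =>
        decide (val y.1 * 2 ^ y.2 ≤ haltNum c y.2 * 2 ^ y.1.length) := by
      refine computable_decide_le (computable_mul (computable_val.comp Computable.fst) ?_)
        (computable_mul ((computable_haltNum c).comp Computable.snd) ?_)
      · exact computable_pow (Computable.const 2) Computable.snd
      · exact computable_pow (Computable.const 2) hlen
    exact Partrec.rfindOpt (computable_ite hcond (Computable.option_some.comp hl)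
      (Computable.const none)).to₂
  obtain ⟨d, hd⟩ := exists_K_le_of_partrec hf
  refine ⟨d, fun n => ?_⟩
  have hstage : ∀ᶠ s in atTop, haltNum c s / 2 ^ (s - n) = val (pre X n) ∧ n ≤ s :=
    (hX n).and (eventually_ge_atTop n)
  have hdom : (f (pre X n)).Dom := by
    obtain ⟨s, hs, hn⟩ := hstage.exists
    refine Nat.rfindOpt_dom.2 ⟨s, (List.range (outBound c s)).map fun _ => false, ?_⟩
    have h1 : val (pre X n) * 2 ^ s ≤ haltNum c s * 2 ^ (pre X n).length := by
      rw [length_pre, ← hs]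
      calc haltNum c s / 2 ^ (s - n) * 2 ^ s
          = haltNum c s / 2 ^ (s - n) * 2 ^ (s - n) * 2 ^ n := by
            rw [mul_assoc, ← pow_add, Nat.sub_add_cancel hn]
        _ ≤ haltNum c s * 2 ^ n := by gcongr; exact Nat.div_mul_le_self _ _
    rw [if_pos (decide_eq_true h1)]
    exact rfl
  obtain ⟨τ, hτ⟩ := Part.dom_iff_mem.1 hdom
  refine le_trans (le_complexity fun q hq => ?_) (hd _ _ hτ)
  obtain ⟨s, hs⟩ := Nat.rfindOpt_spec hτ
  rw [Option.mem_def, Option.ite_none_right_eq_some, decide_eq_true_eq, Option.some.injEq,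
    length_pre] at hs
  obtain ⟨hs, hτs⟩ := hs
  by_contra hlt
  have hlt : q.length < n := by simpa using hlt
  have heval : Encodable.encode τ ∈ c.eval (Encodable.encode q) := by
    rw [hc]
    simpa using hq
  obtain ⟨k, hk⟩ := Code.evaln_complete.1 heval
  -- By stage `s` the program `q` is not seen to halt, as its output `τ` is longer than those seen;
  -- if it halts later, the approximation leaves the interval given by the first `n` digits of `X`.
  have hnot : ¬ halted c s (Encodable.encode q) = true := by
    intro h
    obtain ⟨v, hv⟩ := (halted_iff.1 h).1
    have hv' : v = Encodable.encode τ := Part.mem_unique (Code.evaln_sound hv) heval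
    have := length_lt_outBound hv
    rw [hv', str_encode, ← hτs] at this
    simp at this
  obtain ⟨t, ⟨ht, -⟩, hts⟩ := (hstage.and
    (eventually_ge_atTop (max s (max k (max n (q.length + 1)))))).exists
  simp only [max_le_iff] at hts
  obtain ⟨hst, hkt, hnt, hqt⟩ := hts
  have hyes : halted c t (Encodable.encode q) = true :=
    halted_iff.2 ⟨⟨_, Code.evaln_mono hkt hk⟩, by rw [str_encode], by rw [str_encode]; exact hqt⟩
  have hjump := haltNum_jump c hst hnot hyes
  rw [str_encode] at hjump
  have h1 : haltNum c t < (val (pre X n) + 1) * 2 ^ (t - n) := by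
    rw [← ht, mul_comm]
    exact Nat.lt_mul_div_succ _ (Nat.two_pow_pos _)
  have h2 : val (pre X n) * 2 ^ t ≤ haltNum c s * 2 ^ (t - s) * 2 ^ n := by
    calc val (pre X n) * 2 ^ t = val (pre X n) * 2 ^ s * 2 ^ (t - s) := by
          rw [mul_assoc, ← pow_add, Nat.add_sub_of_le hst]
      _ ≤ haltNum c s * 2 ^ n * 2 ^ (t - s) := by gcongr
      _ = _ := by ring
  have h3 : (2 : ℕ) ^ t ≤ 2 ^ (t - (q.length + 1)) * 2 ^ n := by
    rw [← pow_add]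
    exact Nat.pow_le_pow_right two_pos (by omega)
  have h4 : (val (pre X n) + 1) * 2 ^ (t - n) * 2 ^ n = (val (pre X n) + 1) * 2 ^ t := by
    rw [mul_assoc, ← pow_add, Nat.sub_add_cancel hnt]
  have h5 := Nat.mul_le_mul_right (2 ^ n) hjump
  have h6 := Nat.mul_lt_mul_of_pos_right h1 (Nat.two_pow_pos n)
  rw [h4] at h6
  nlinarith

/-- There is a Martin-Löf random real with a nondecreasing computable sequence of dyadic
approximations. -/
theorem exists_random_approximation : ∃ (W : ℕ → ℕ) (X : ℕ → Bool), Computable W ∧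
    (∀ s, 2 * W s ≤ W (s + 1)) ∧ (∀ s, W s < 2 ^ s) ∧ MLRandomSeq X ∧
    ∀ n, ∀ᶠ s in atTop, W s / 2 ^ (s - n) = val (pre X n) := by
  obtain ⟨c, hc⟩ := exists_isCodeU
  obtain ⟨X, hX⟩ := exists_limit_digits (two_mul_haltNum_le c) hc.haltNum_lt
  exact ⟨haltNum c, X, computable_haltNum c, two_mul_haltNum_le c, hc.haltNum_lt,
    hc.mlRandomSeq hX, hX⟩

/-! ### Long constant blocks refute Schnorr randomness -/

/-- The numerator, over `2 ^ |σ|`, of the capital at `σ` of the gambler who splits an initial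
capital of `1` among accounts number `0, 1, 2, ...` with shares `2^(-1), 2^(-2), 2^(-3), ...`,
account `j` betting everything on the digit `b` from position `j` on. It depends only on the number
of final digits `b` of `σ`. -/
def blockNum (b : Bool) (σ : List Bool) : ℕ :=
  σ.foldl (fun A d => if decide (d = b) = true then 4 * A - 1 else 1) 1

theorem blockNum_append (b d : Bool) (σ : List Bool) :
    blockNum b (σ ++ [d]) = if d = b then 4 * blockNum b σ - 1 else 1 := by
  simp [blockNum]

theorem one_le_blockNum (b : Bool) (σ : List Bool) : 1 ≤ blockNum b σ := by
  induction σ using List.reverseRecOn with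
  | nil => simp [blockNum]
  | append_singleton σ d ih =>
    rw [blockNum_append]
    split <;> omega

theorem computable_blockNum (b : Bool) : Computable (blockNum b) := by
  refine (Primrec.list_foldl (f := fun σ : List Bool => σ) (g := fun _ => 1)
    (h := fun _ (p : ℕ × Bool) => if decide (p.2 = b) = true then 4 * p.1 - 1 else 1)
    Primrec.id (Primrec.const 1) ?_).to_comp
  have h1 : Primrec fun y : List Bool × ℕ × Bool => decide (y.2.2 = b) :=
    (Primrec.dom_bool fun d => decide (d = b)).comp (Primrec.snd.comp Primrec.snd)
  refine (Primrec.cond h1 (Primrec.nat_sub.comp (Primrec.nat_mul.comp (Primrec.const 4)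
    (Primrec.fst.comp Primrec.snd)) (Primrec.const 1)) (Primrec.const 1)).of_eq fun y =>
    Bool.cond_eq_ite _ _ _

/-- The martingale with numerator `blockNum`. -/
noncomputable def blockMart (b : Bool) (σ : List Bool) : ℝ := blockNum b σ / 2 ^ σ.length

theorem isMartingale_blockMart (b : Bool) : IsMartingale (blockMart b) := by
  refine ⟨fun σ => by unfold blockMart; positivity, fun σ => ?_⟩
  have h1 := one_le_blockNum b σ
  have h2 : ((4 * blockNum b σ - 1 : ℕ) : ℝ) = 4 * blockNum b σ - 1 := by
    rw [Nat.cast_sub (by omega)]; push_cast; ring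
  simp only [blockMart, blockNum_append, List.length_append, List.length_singleton, pow_succ]
  have h3 : (0 : ℝ) < 2 ^ σ.length := by positivity
  cases b <;> simp only [if_true, Bool.false_eq_true, Bool.true_eq_false, if_false, h2] <;>
    field_simp <;> push_cast <;> ring

theorem nat_div_pow_approx (A k n : ℕ) :
    |(A : ℝ) / 2 ^ n - ((A * 2 ^ k / 2 ^ n : ℕ) : ℝ) / 2 ^ k| ≤ 1 / 2 ^ k := by
  have h1 : A * 2 ^ k / 2 ^ n * 2 ^ n ≤ A * 2 ^ k := Nat.div_mul_le_self _ _
  have h2 : A * 2 ^ k < 2 ^ n * (A * 2 ^ k / 2 ^ n + 1) :=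
    Nat.lt_mul_div_succ _ (Nat.two_pow_pos n)
  have h1' : ((A * 2 ^ k / 2 ^ n : ℕ) : ℝ) * 2 ^ n ≤ A * 2 ^ k := by exact_mod_cast h1
  have h2' : (A : ℝ) * 2 ^ k < 2 ^ n * (((A * 2 ^ k / 2 ^ n : ℕ) : ℝ) + 1) := by
    exact_mod_cast h2
  generalize ((A * 2 ^ k / 2 ^ n : ℕ) : ℝ) = q at *
  rw [div_sub_div _ _ (by positivity) (by positivity), abs_div,
    abs_of_pos (by positivity : (0 : ℝ) < 2 ^ n * 2 ^ k),
    div_le_div_iff₀ (by positivity) (by positivity)]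
  have h3 : |(A : ℝ) * 2 ^ k - 2 ^ n * q| ≤ 2 ^ n := by
    rw [abs_le]; constructor <;> linarith [pow_pos (two_pos (α := ℝ)) n]
  have h4 := mul_le_mul_of_nonneg_right h3 (by positivity : (0 : ℝ) ≤ 2 ^ k)
  linarith

theorem isRecursiveReal_blockMart (b : Bool) : IsRecursiveReal (blockMart b) := by
  refine ⟨fun σ k => blockNum b σ * 2 ^ k / 2 ^ σ.length, ?_, fun σ k => nat_div_pow_approx _ _ _⟩
  have hlen : Computable fun y : List Bool × ℕ => y.1.length :=
    Primrec.list_length.to_comp.comp Computable.fst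
  refine computable_div (computable_mul ((computable_blockNum b).comp Computable.fst) ?_) ?_
  · exact computable_pow (Computable.const 2) Computable.snd
  · exact computable_pow (Computable.const 2) hlen

theorem le_blockNum_of_block {b : Bool} {Y : ℕ → Bool} {m l : ℕ}
    (h : ∀ k, m ≤ k → k < m + l → Y k = b) : 4 ^ l + 1 ≤ 2 * blockNum b (pre Y (m + l)) := by
  induction l with
  | zero => have := one_le_blockNum b (pre Y (m + 0)); omega
  | succ l ih =>
    have h1 := ih fun k h1 h2 => h k h1 (by omega)
    rw [← add_assoc, pre_succ, blockNum_append, if_pos (h _ (by omega) (by omega)), pow_succ]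
    omega

/-- After constant digits at the positions `m, ..., 3 * m - 1` the capital is at least
`2 ^ (m - 1)`, far above the recursive bound `m / 2`. -/
theorem not_schnorrRandomSeq_of_blocks {b : Bool} {Y : ℕ → Bool}
    (h : ∀ N, ∃ m ≥ N, ∀ k, m ≤ k → k < m + 2 * m → Y k = b) : ¬ SchnorrRandomSeq Y := by
  have hbig : ∀ N, ∃ m ≥ N, (2 : ℝ) ^ m / 2 ≤ blockMart b (pre Y (3 * m)) := by
    intro N
    obtain ⟨m, hm, hblk⟩ := h N
    refine ⟨m, hm, ?_⟩
    have h1 := le_blockNum_of_block hblk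
    rw [show m + 2 * m = 3 * m by ring] at h1
    have h2 : ((4 : ℝ) ^ (2 * m) + 1) ≤ 2 * blockNum b (pre Y (3 * m)) := by exact_mod_cast h1
    rw [blockMart, length_pre, div_le_div_iff₀ (by norm_num) (by positivity), ← pow_add]
    have h3 : (4 : ℝ) ^ (2 * m) = 2 ^ (m + 3 * m) := by
      rw [show (4 : ℝ) = 2 ^ 2 by norm_num, ← pow_mul]; congr 1; ring
    linarith
  refine not_not.2 ⟨blockMart b, isMartingale_blockMart b, isRecursiveReal_blockMart b, ?_,
    fun n => n / 6, ?_, ?_, ?_, ?_⟩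
  · intro C
    rw [frequently_atTop]
    intro N
    obtain ⟨B, hB⟩ := exists_nat_ge (2 * C)
    obtain ⟨m, hm, h1⟩ := hbig (max N B)
    rw [ge_iff_le, max_le_iff] at hm
    refine ⟨3 * m, by omega, lt_of_lt_of_le ?_ h1⟩
    have h2 : (B : ℝ) ≤ m := by exact_mod_cast hm.2
    have h3 : (m : ℝ) < 2 ^ m := by exact_mod_cast Nat.lt_two_pow_self
    linarith
  · exact computable_div Computable.id (Computable.const 6)
  · exact fun m n h => Nat.div_le_div_right h
  · exact fun c => ⟨6 * c, by simp⟩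
  · rw [frequently_atTop]
    intro N
    obtain ⟨m, hm, h1⟩ := hbig N
    refine ⟨3 * m, by omega, le_trans ?_ h1⟩
    have h2 : 3 * m / 6 * 2 ≤ 2 ^ m := by
      have : m < 2 ^ m := Nat.lt_two_pow_self
      omega
    have h3 : ((3 * m / 6 : ℕ) : ℝ) * 2 ≤ 2 ^ m := by exact_mod_cast h2
    linarith

theorem not_schnorrRandomSeq_of_eventually {b : Bool} {Y : ℕ → Bool}
    (h : ∀ᶠ k in atTop, Y k = b) : ¬ SchnorrRandomSeq Y := by
  obtain ⟨N₀, h₀⟩ := eventually_atTop.1 h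
  exact not_schnorrRandomSeq_of_blocks fun N =>
    ⟨max N N₀, le_max_left _ _, fun k hk _ => h₀ k ((le_max_right _ _).trans hk)⟩

/-! ### Uniqueness of binary expansions -/

/-- The contribution of the digit `X n` to `binaryValue X`. -/
noncomputable def digitTerm (X : ℕ → Bool) (n : ℕ) : ℝ := if X n then ((2 : ℝ) ^ (n + 1))⁻¹ else 0

theorem hasSum_inv_two_pow (n : ℕ) :
    HasSum (fun k => ((2 : ℝ) ^ (k + (n + 1) + 1))⁻¹) ((2 : ℝ) ^ (n + 1))⁻¹ := by
  refine (hasSum_geometric_two' _).congr_fun fun k => ?_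
  rw [pow_add, pow_add 2 k]
  field_simp

theorem hasSum_binaryValue (X : ℕ → Bool) : HasSum (digitTerm X) (binaryValue X) := by
  refine Summable.hasSum ?_
  refine Summable.of_nonneg_of_le (fun n => ?_) (fun n => ?_) summable_geometric_two
  · unfold digitTerm; split <;> positivity
  · unfold digitTerm
    have h : ((2 : ℝ) ^ (n + 1))⁻¹ ≤ (1 / 2) ^ n := by
      rw [one_div, inv_pow]
      exact inv_anti₀ (by positivity) (pow_le_pow_right₀ one_le_two (Nat.le_succ n))
    split
    · exact h
    · positivity

/-- After the first difference, the remaining digits must make up for a whole unit, so all of them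
differ in the same direction. -/
theorem constant_of_binaryValue_eq {Y Z : ℕ → Bool} (h : binaryValue Y = binaryValue Z) {n : ℕ}
    (hlt : ∀ k < n, Y k = Z k) (hY : Y n = true) (hZ : Z n = false) :
    ∀ k > n, Y k = false ∧ Z k = true := by
  have h1 := (hasSum_binaryValue Y).sub (hasSum_binaryValue Z)
  rw [h, sub_self] at h1
  have h2 := (hasSum_nat_add_iff' (n + 1)).2 h1
  have h3 : ∑ i ∈ Finset.range (n + 1), (digitTerm Y i - digitTerm Z i)
      = ((2 : ℝ) ^ (n + 1))⁻¹ := by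
    rw [Finset.sum_range_succ, Finset.sum_eq_zero]
    · simp [digitTerm, hY, hZ]
    · intro k hk
      simp [digitTerm, hlt k (Finset.mem_range.1 hk)]
  rw [h3] at h2
  have h4 := (hasSum_inv_two_pow n).add h2
  rw [zero_sub, add_neg_cancel] at h4
  have h5 := (hasSum_zero_iff_of_nonneg ?_).1 h4
  · intro k hk
    obtain ⟨j, rfl⟩ := Nat.exists_eq_add_of_lt hk
    have h6 := congrFun h5 j
    have h7 : (0 : ℝ) < ((2 : ℝ) ^ (j + (n + 1) + 1))⁻¹ := by positivity
    rw [show n + j + 1 = j + (n + 1) by ring]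
    cases hy : Y (j + (n + 1)) <;> cases hz : Z (j + (n + 1)) <;>
      simp only [digitTerm, hy, hz, Pi.zero_apply, if_true, Bool.false_eq_true, if_false] at h6 <;>
      first | exact ⟨rfl, rfl⟩ | linarith
  · intro k
    have h7 : (0 : ℝ) < ((2 : ℝ) ^ (k + (n + 1) + 1))⁻¹ := by positivity
    cases hy : Y (k + (n + 1)) <;> cases hz : Z (k + (n + 1)) <;>
      simp only [digitTerm, hy, hz, if_true, Bool.false_eq_true, if_false] <;>
      linarith

theorem eventually_const_of_binaryValue_eq {Y Z : ℕ → Bool} (h : binaryValue Y = binaryValue Z)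
    (hne : Y ≠ Z) : ∃ b, ∀ᶠ k in atTop, Z k = b := by
  have hex : ∃ n, Y n ≠ Z n := Function.ne_iff.1 hne
  classical
  have hlt : ∀ k < Nat.find hex, Y k = Z k := fun k hk => not_not.1 (Nat.find_min hex hk)
  have hn := Nat.find_spec hex
  set n := Nat.find hex
  cases hy : Y n <;> cases hz : Z n
  · exact absurd (hy.trans hz.symm) hn
  · exact ⟨false, (eventually_gt_atTop n).mono fun k hk =>
      (constant_of_binaryValue_eq h.symm (fun k hk => (hlt k hk).symm) hz hy k hk).1⟩
  · exact ⟨true, (eventually_gt_atTop n).mono fun k hk =>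
      (constant_of_binaryValue_eq h hlt hy hz k hk).2⟩
  · exact absurd (hy.trans hz.symm) hn

/-- If one expansion is not Schnorr random, neither is the other expansion, if there is one. -/
theorem not_schnorrRandom_binaryValue {Y : ℕ → Bool} (hY : ¬ SchnorrRandomSeq Y) :
    ¬ SchnorrRandom (binaryValue Y) := by
  rintro ⟨Z, hZ, hr⟩
  by_cases hne : Y = Z
  · exact hY (hne ▸ hr)
  · obtain ⟨b, hb⟩ := eventually_const_of_binaryValue_eq hZ.symm hne
    exact not_schnorrRandomSeq_of_eventually hb hr

/-! ### Left-r.e. numberings from increasing dyadic approximations -/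

/-- The domain may consist, at each length `n`, of the first `D n` strings. -/
theorem isDomainSum_of_hasSum {D : ℕ → ℕ} (hD : ∀ n, D n ≤ 2 ^ n) {r : ℝ}
    (hr : HasSum (fun n => (D n : ℝ) / 2 ^ n) r) {f : List Bool →. ℕ}
    (hf : ∀ σ, (f σ).Dom ↔ val σ < D σ.length) : IsDomainSum f r := by
  let e : {σ : List Bool // (f σ).Dom} → Σ n, Fin (D n) :=
    fun σ => ⟨σ.1.length, ⟨val σ.1, (hf σ.1).1 σ.2⟩⟩
  have he : Function.Bijective e := by
    constructor
    · rintro ⟨σ, hσ⟩ ⟨τ, hτ⟩ h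
      rw [Sigma.mk.inj_iff] at h
      obtain ⟨h1, h2⟩ := h
      have h3 : val σ = val τ := (Fin.heq_ext_iff (by rw [h1])).1 h2
      exact Subtype.ext (val_injective h1 h3)
    · rintro ⟨n, m, hm⟩
      obtain ⟨σ, rfl, rfl⟩ := exists_val n m (hm.trans_le (hD n))
      exact ⟨⟨σ, (hf σ).2 hm⟩, rfl⟩
  let g : (Σ n, Fin (D n)) → ℝ := fun y => ((2 : ℝ) ^ y.1)⁻¹
  have hin : ∀ n, HasSum (fun m : Fin (D n) => g ⟨n, m⟩) ((D n : ℝ) / 2 ^ n) := by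
    intro n
    have := hasSum_fintype fun m : Fin (D n) => g ⟨n, m⟩
    simpa [g, div_eq_mul_inv] using this
  have hsum : Summable g := by
    rw [summable_sigma_of_nonneg fun y => by positivity]
    refine ⟨fun n => (hin n).summable, ?_⟩
    simp only [(hin _).tsum_eq]
    exact hr.summable
  have hg : HasSum g r := HasSum.sigma_of_hasSum hr hin hsum
  exact (Equiv.ofBijective e he).hasSum_iff.2 hg

/-- A uniformly computable family of nondecreasing sequences of dyadic rationals in `[0, 1]`
converges to a left-r.e. numbering. -/
theorem exists_numbering {P E : ℕ → ℕ → ℕ} (hP : Computable₂ P) (hE : Computable₂ E)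
    (h0 : ∀ x, P x 0 = 0) (hmono : ∀ x, Monotone fun s => (P x s : ℝ) / 2 ^ E x s)
    (hle : ∀ x s, (P x s : ℝ) / 2 ^ E x s ≤ 1) :
    ∃ β, IsLeftRENumbering β ∧ ∀ x, Tendsto (fun s => (P x s : ℝ) / 2 ^ E x s) atTop (𝓝 (β x)) := by
  let q : ℕ → ℕ → ℝ := fun x s => (P x s : ℝ) / 2 ^ E x s
  have hbdd : ∀ x, BddAbove (Set.range (q x)) := fun x => ⟨1, by rintro _ ⟨s, rfl⟩; exact hle x s⟩
  have hlim : ∀ x, Tendsto (q x) atTop (𝓝 (⨆ s, q x s)) := fun x =>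
    tendsto_atTop_ciSup (hmono x) (hbdd x)
  -- Truncate to denominators `2 ^ s`; the increments are realised by strings of length `s`.
  let N : ℕ → ℕ → ℕ := fun x s => P x s * 2 ^ s / 2 ^ E x s
  have hNle : ∀ x s, (N x s : ℝ) ≤ 2 ^ s * q x s ∧ 2 ^ s * q x s < N x s + 1 := by
    intro x s
    have h1 : P x s * 2 ^ s / 2 ^ E x s * 2 ^ E x s ≤ P x s * 2 ^ s := Nat.div_mul_le_self _ _
    have h2 : P x s * 2 ^ s < 2 ^ E x s * (P x s * 2 ^ s / 2 ^ E x s + 1) :=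
      Nat.lt_mul_div_succ _ (Nat.two_pow_pos _)
    have h1' : (N x s : ℝ) * 2 ^ E x s ≤ P x s * 2 ^ s := by exact_mod_cast h1
    have h2' : (P x s : ℝ) * 2 ^ s < 2 ^ E x s * (N x s + 1) := by exact_mod_cast h2
    simp only [q]
    rw [mul_div_assoc', le_div_iff₀ (by positivity), div_lt_iff₀ (by positivity)]
    constructor <;> linarith
  have hN2 : ∀ x s, 2 * N x s ≤ N x (s + 1) := by
    intro x s
    have h1 := (hNle x s).1
    have h2 := (hNle x (s + 1)).2
    have h3 : (2 : ℝ) ^ s * q x s ≤ 2 ^ s * q x (s + 1) :=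
      mul_le_mul_of_nonneg_left (hmono x (Nat.le_succ s)) (by positivity)
    rw [pow_succ] at h2
    have h4 : (2 * N x s : ℝ) < N x (s + 1) + 1 := by linarith
    exact Nat.lt_succ_iff.1 (by exact_mod_cast h4)
  have hNp : ∀ x s, N x s ≤ 2 ^ s := by
    intro x s
    have h1 := (hNle x s).1
    have h2 : (2 : ℝ) ^ s * q x s ≤ 2 ^ s * 1 := mul_le_mul_of_nonneg_left (hle x s) (by positivity)
    have h3 : (N x s : ℝ) ≤ 2 ^ s := by linarith
    exact_mod_cast h3
  have hN0 : ∀ x, N x 0 = 0 := fun x => by simp [N, h0]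
  have hNlim : ∀ x, Tendsto (fun s => (N x s : ℝ) / 2 ^ s) atTop (𝓝 (⨆ s, q x s)) := by
    intro x
    have h1 : Tendsto (fun s : ℕ => q x s - (1 / 2) ^ s) atTop (𝓝 (⨆ s, q x s)) := by
      simpa using (hlim x).sub (tendsto_pow_atTop_nhds_zero_of_lt_one
        (by norm_num : (0 : ℝ) ≤ 1 / 2) (by norm_num))
    refine tendsto_of_tendsto_of_tendsto_of_le_of_le h1 (hlim x) (fun s => ?_) fun s => ?_
    · have := (hNle x s).2
      simp only
      rw [le_div_iff₀ (by positivity), sub_mul, ← mul_pow]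
      norm_num
      linarith
    · have := (hNle x s).1
      simp only
      rw [div_le_iff₀ (by positivity)]
      linarith
  let D : ℕ → ℕ → ℕ := fun x n => N x n - 2 * N x (n - 1)
  have hD : ∀ x, HasSum (fun n => (D x n : ℝ) / 2 ^ n) (⨆ s, q x s) := by
    intro x
    rw [hasSum_iff_tendsto_nat_of_nonneg fun n => by positivity]
    rw [← tendsto_add_atTop_iff_nat 1]
    refine (hNlim x).congr fun s => ?_
    induction s with
    | zero => simp [D, hN0]
    | succ s ih =>
      rw [Finset.sum_range_succ, ← ih]
      simp only [D, Nat.add_sub_cancel]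
      rw [Nat.cast_sub (hN2 x s), pow_succ]
      push_cast
      field_simp
      ring
  have hNc : Computable₂ N :=
    computable_div (computable_mul hP (computable_pow (Computable.const 2) Computable.snd))
      (computable_pow (Computable.const 2) hE)
  have hDc : Computable₂ D :=
    computable_sub hNc (computable_mul (Computable.const 2)
      (hNc.comp Computable.fst (computable_sub Computable.snd (Computable.const 1))))
  let φ : ℕ → List Bool →. ℕ := fun x σ =>
    ((if decide (val σ < D x σ.length) = true then some 0 else none : Option ℕ) : Part ℕ)
  have hφ : Partrec₂ φ := by
    have hlen : Computable fun y : ℕ × List Bool => y.2.length :=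
      Primrec.list_length.to_comp.comp Computable.snd
    exact (computable_ite (computable_decide_lt (computable_val.comp Computable.snd)
      (hDc.comp Computable.fst hlen)) (Computable.const (some 0)) (Computable.const none)).ofOption
  refine ⟨fun x => ⨆ s, q x s, ⟨fun x => ⟨?_, ciSup_le (hle x)⟩, φ, hφ, fun x => ?_⟩, hlim⟩
  · exact Real.iSup_nonneg fun s => by positivity
  · refine isDomainSum_of_hasSum (fun n => (Nat.sub_le _ _).trans (hNp x n)) (hD x) fun σ => ?_
    have hdom : ∀ m d : ℕ,
        ((if decide (m < d) = true then some 0 else none : Option ℕ) : Part ℕ).Dom ↔ m < d := by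
      intro m d
      by_cases h : m < d <;> simp [h]
    exact hdom _ _

/-! ### `Σ₃` sets as sets of bounded limits inferior -/

/-- Search for witnesses: in state `(b, c)`, if `p b c` holds, go on to `(b + 1, 0)`, and otherwise
try `(b, c + 1)`. -/
def search (p : ℕ → ℕ → Bool) (s : ℕ) : ℕ × ℕ :=
  Nat.rec (0, 0) (fun _ y => if p y.1 y.2 = true then (y.1 + 1, 0) else (y.1, y.2 + 1)) s

theorem search_succ (p : ℕ → ℕ → Bool) (s : ℕ) : search p (s + 1) =
    if p (search p s).1 (search p s).2 = true then ((search p s).1 + 1, 0)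
      else ((search p s).1, (search p s).2 + 1) := rfl

theorem search_fst_mono (p : ℕ → ℕ → Bool) : Monotone fun s => (search p s).1 := by
  refine monotone_nat_of_le_succ fun s => ?_
  rw [search_succ]
  split <;> simp

/-- In state `(b, c)`, all numbers below `b` have witnesses, and `b` has none below `c`. -/
theorem search_spec (p : ℕ → ℕ → Bool) (s : ℕ) :
    (∀ b < (search p s).1, ∃ c, p b c = true) ∧
      ∀ c < (search p s).2, ¬ p (search p s).1 c = true := by
  induction s with
  | zero =>
    exact ⟨fun b hb => absurd hb (Nat.not_lt_zero _), fun c hc => absurd hc (Nat.not_lt_zero _)⟩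
  | succ s ih =>
    rw [search_succ]
    split
    · rename_i h
      refine ⟨fun b hb => ?_, fun c hc => absurd hc (Nat.not_lt_zero _)⟩
      rcases Nat.lt_succ_iff_lt_or_eq.1 hb with hb | rfl
      · exact ih.1 b hb
      · exact ⟨_, h⟩
    · rename_i h
      refine ⟨ih.1, fun c hc => ?_⟩
      rcases Nat.lt_succ_iff_lt_or_eq.1 hc with hc | rfl
      · exact ih.2 c hc
      · exact h

/-- The search succeeds infinitely often if and only if every `b` has a witness. -/
theorem frequently_search_iff (p : ℕ → ℕ → Bool) :
    (∃ᶠ s in atTop, p (search p s).1 (search p s).2 = true) ↔ ∀ b, ∃ c, p b c = true := by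
  constructor
  · intro h b
    have hex : ∀ b, ∃ s, b ≤ (search p s).1 := by
      intro b
      induction b with
      | zero => exact ⟨0, Nat.zero_le _⟩
      | succ b ih =>
        obtain ⟨s, hs⟩ := ih
        obtain ⟨t, ht, hp⟩ := frequently_atTop.1 h s
        refine ⟨t + 1, ?_⟩
        rw [search_succ, if_pos hp]
        exact Nat.succ_le_succ (hs.trans (search_fst_mono p ht))
    obtain ⟨s, hs⟩ := hex (b + 1)
    exact (search_spec p s).1 b hs
  · intro h
    by_contra hcon
    obtain ⟨s, hs⟩ := eventually_atTop.1 (not_frequently.1 hcon)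
    have hrun : ∀ k, search p (s + k) = ((search p s).1, (search p s).2 + k) := by
      intro k
      induction k with
      | zero => rfl
      | succ k ih =>
        rw [← add_assoc, search_succ, if_neg (hs _ (Nat.le_add_right s k)), ih]
        rfl
    obtain ⟨c, hc⟩ := h (search p s).1
    have h1 := (search_spec p (s + (c + 1))).2 c
    rw [hrun] at h1
    exact h1 (by simp only; omega) hc

theorem computable_search {α : Type*} [Primcodable α] {p : α → ℕ → ℕ → Bool}
    (hp : Computable fun y : α × ℕ × ℕ => p y.1 y.2.1 y.2.2) :
    Computable₂ fun a s => search (p a) s := by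
  have hst : Computable fun y : (α × ℕ) × ℕ × ℕ × ℕ => y.2.2 := Computable.snd.comp Computable.snd
  have hb : Computable fun y : (α × ℕ) × ℕ × ℕ × ℕ => y.2.2.1 := Computable.fst.comp hst
  have hc : Computable fun y : (α × ℕ) × ℕ × ℕ × ℕ => y.2.2.2 := Computable.snd.comp hst
  have hcond : Computable fun y : (α × ℕ) × ℕ × ℕ × ℕ => p y.1.1 y.2.2.1 y.2.2.2 :=
    hp.comp ((Computable.fst.comp Computable.fst).pair hst)
  have h1 : Computable fun y : (α × ℕ) × ℕ × ℕ × ℕ => (y.2.2.1 + 1, 0) :=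
    (computable_add hb (Computable.const 1)).pair (Computable.const 0)
  have h2 : Computable fun y : (α × ℕ) × ℕ × ℕ × ℕ => (y.2.2.1, y.2.2.2 + 1) :=
    hb.pair (computable_add hc (Computable.const 1))
  exact Computable.nat_rec (f := fun y : α × ℕ => y.2) (g := fun _ => ((0, 0) : ℕ × ℕ))
    (h := fun y z => if p y.1 z.2.1 z.2.2 = true then (z.2.1 + 1, 0) else (z.2.1, z.2.2 + 1))
    Computable.snd (Computable.const (0, 0)) (computable_ite hcond h1 h2).to₂

theorem exists_liminf {p : ℕ × ℕ → ℕ → ℕ → Bool}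
    (hp : Computable fun y : (ℕ × ℕ) × ℕ × ℕ => p y.1 y.2.1 y.2.2) :
    ∃ h : ℕ → ℕ → ℕ, Computable₂ h ∧
      ∀ x, (∃ a, ∀ b, ∃ c, p (x, a) b c = true) ↔ ∃ v, ∃ᶠ t in atTop, h x t ≤ v := by
  let ev : ℕ × ℕ → ℕ → Bool := fun y s => p y (search (p y) s).1 (search (p y) s).2
  -- Stage `t = ⟨a, s⟩` simulates step `s` of the search for witnesses for `a`.
  let h : ℕ → ℕ → ℕ := fun x t => if ev (x, t.unpair.1) t.unpair.2 = true then t.unpair.1 else t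
  refine ⟨h, ?_, fun x => ?_⟩
  · have hs : Computable fun y : (ℕ × ℕ) × ℕ => search (p y.1) y.2 := computable_search hp
    have hpair : Computable fun y : (ℕ × ℕ) × ℕ => (y.1, search (p y.1) y.2) :=
      Computable.fst.pair hs
    have he : Computable fun y : (ℕ × ℕ) × ℕ => ev y.1 y.2 := by
      have h := hp.comp hpair
      exact h
    have h1 : Computable fun y : ℕ × ℕ => y.2.unpair.1 :=
      Computable.fst.comp (Computable.unpair.comp Computable.snd)
    have h2 : Computable fun y : ℕ × ℕ => y.2.unpair.2 :=
      Computable.snd.comp (Computable.unpair.comp Computable.snd)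
    have hcond : Computable fun y : ℕ × ℕ => ev (y.1, y.2.unpair.1) y.2.unpair.2 :=
      he.comp ((Computable.fst.pair h1).pair h2)
    exact computable_ite hcond h1 Computable.snd
  · simp only [← frequently_search_iff]
    constructor
    · rintro ⟨a, ha⟩
      refine ⟨a, frequently_atTop.2 fun T => ?_⟩
      obtain ⟨s, hs, he⟩ := frequently_atTop.1 ha T
      refine ⟨Nat.pair a s, hs.trans (Nat.right_le_pair a s), ?_⟩
      have he' : ev (x, a) s = true := he
      simp [h, he']
    · rintro ⟨v, hv⟩
      by_contra hcon
      simp only [not_exists, not_frequently] at hcon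
      have hall : ∀ᶠ s in atTop, ∀ a ∈ Finset.range (v + 1), ¬ ev (x, a) s = true :=
        (eventually_all_finset _).2 fun a _ => hcon a
      obtain ⟨S, hS⟩ := eventually_atTop.1 hall
      obtain ⟨t, ht, hle⟩ := frequently_atTop.1 hv ((max v S + 1) ^ 2)
      have hvt : v < t := by
        have h1 : v < max v S + 1 := Nat.lt_succ_of_le (le_max_left _ _)
        have h2 : max v S + 1 ≤ (max v S + 1) ^ 2 := Nat.le_self_pow two_ne_zero _
        omega
      simp only [h] at hle
      split at hle
      · rename_i he
        have hSt : S ≤ t.unpair.2 := by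
          by_contra hlt
          have h1 := Nat.pair_lt_max_add_one_sq t.unpair.1 t.unpair.2
          rw [Nat.pair_unpair] at h1
          have h2 : (max t.unpair.1 t.unpair.2 + 1) ^ 2 ≤ (max v S + 1) ^ 2 := by
            gcongr
            omega
          omega
        exact hS _ hSt _ (Finset.mem_range.2 (Nat.lt_succ_of_le hle)) he
      · omega

/-- Every `Σ₃` set is the set of `x` for which `liminf_t h(x, t)` is finite, for a recursive `h`. -/
theorem IsSigma3.exists_liminf {A : Set ℕ} (hA : IsSigma3 A) :
    ∃ h : ℕ → ℕ → ℕ, Computable₂ h ∧ ∀ x, x ∈ A ↔ ∃ v, ∃ᶠ t in atTop, h x t ≤ v := by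
  obtain ⟨R, ⟨hdec, hR⟩, hAR⟩ := hA
  have hy : Computable fun y : (ℕ × ℕ) × ℕ × ℕ => (y.1.1, y.1.2, y.2.1, y.2.2) :=
    (Computable.fst.comp Computable.fst).pair ((Computable.snd.comp Computable.fst).pair
      Computable.snd)
  obtain ⟨h, hh, hiff⟩ := LeftRE.exists_liminf (p := fun y b c => decide (R (y.1, y.2, b, c)))
    (hR.comp hy)
  exact ⟨h, hh, fun x => by rw [hAR, ← hiff]; simp⟩

/-! ### Moving binary digits to later positions -/

/-- The number obtained from the `n`-digit binary numeral of `W` by moving its digit number `i` to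
the place of value `2 ^ (-e i)`. -/
noncomputable def spread (e : ℕ → ℕ) (n W : ℕ) : ℝ :=
  ∑ i ∈ Finset.range n, ((W / 2 ^ (n - 1 - i) % 2 : ℕ) : ℝ) / 2 ^ e i

theorem spread_succ (e : ℕ → ℕ) (n W : ℕ) :
    spread e (n + 1) W = spread e n (W / 2) + ((W % 2 : ℕ) : ℝ) / 2 ^ e n := by
  rw [spread, spread, Finset.sum_range_succ]
  congr 1
  · refine Finset.sum_congr rfl fun i hi => ?_
    have h : n + 1 - 1 - i = (n - 1 - i) + 1 := by
      have := Finset.mem_range.1 hi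
      omega
    rw [h, pow_succ', ← Nat.div_div_eq_div_mul]
  · simp

/-- A greater numeral gives a number greater by at least one unit in the last place. -/
theorem spread_add_le {e : ℕ → ℕ} (he : StrictMono e) {n W W' : ℕ} (h : W < W')
    (h' : W' < 2 ^ (n + 1)) : spread e (n + 1) W + 1 / 2 ^ e n ≤ spread e (n + 1) W' := by
  induction n generalizing W W' with
  | zero =>
    obtain rfl : W = 0 := by omega
    obtain rfl : W' = 1 := by omega
    simp [spread]
  | succ n ih =>
    rw [spread_succ e (n + 1) W, spread_succ e (n + 1) W']
    have hε : (1 : ℝ) / 2 ^ e (n + 1) + 1 / 2 ^ e (n + 1) ≤ 1 / 2 ^ e n := by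
      have h1 : (2 : ℝ) ^ (e n + 1) ≤ 2 ^ e (n + 1) :=
        pow_le_pow_right₀ one_le_two (he (Nat.lt_succ_self n))
      rw [pow_succ] at h1
      rw [← add_div, div_le_div_iff₀ (by positivity) (by positivity)]
      linarith
    rcases (Nat.div_le_div_right h.le : W / 2 ≤ W' / 2).lt_or_eq with hlt | heq
    · have h1 := ih hlt (by rw [pow_succ] at h'; omega)
      have h2 : ((W % 2 : ℕ) : ℝ) / 2 ^ e (n + 1) ≤ 1 / 2 ^ e (n + 1) := by
        gcongr
        exact_mod_cast Nat.lt_succ_iff.1 (Nat.mod_lt W two_pos)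
      have h3 : (0 : ℝ) ≤ ((W' % 2 : ℕ) : ℝ) / 2 ^ e (n + 1) := by positivity
      linarith
    · obtain ⟨h1, h2⟩ : W % 2 = 0 ∧ W' % 2 = 1 := by omega
      rw [heq, h1, h2]
      simp

theorem spread_mono {e : ℕ → ℕ} (he : StrictMono e) {n W W' : ℕ} (h : W ≤ W')
    (h' : W' < 2 ^ n) : spread e n W ≤ spread e n W' := by
  rcases h.eq_or_lt with rfl | h
  · exact le_rfl
  · rcases n with _ | n
    · simp [spread]
    · have h1 := spread_add_le he h h'
      have h2 : (0 : ℝ) ≤ 1 / 2 ^ e n := by positivity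
      linarith

theorem spread_anti {e e' : ℕ → ℕ} {n : ℕ} (h : ∀ i < n, e i ≤ e' i) (W : ℕ) :
    spread e' n W ≤ spread e n W := by
  refine Finset.sum_le_sum fun i hi => ?_
  have := h i (Finset.mem_range.1 hi)
  gcongr
  exact one_le_two

theorem spread_congr {e e' : ℕ → ℕ} {n : ℕ} (h : ∀ i < n, e i = e' i) (W : ℕ) :
    spread e n W = spread e' n W :=
  Finset.sum_congr rfl fun i hi => by rw [h i (Finset.mem_range.1 hi)]

/-- Cutting off all but the first `n` digits changes the value by less than `2^(-n)`. -/
theorem spread_trunc {e : ℕ → ℕ} (he : ∀ i, i < e i) {n s : ℕ} (hns : n ≤ s) (W : ℕ) :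
    spread e n (W / 2 ^ (s - n)) ≤ spread e s W ∧
      spread e s W ≤ spread e n (W / 2 ^ (s - n)) + (1 / 2 ^ n - 1 / 2 ^ s) := by
  induction s, hns using Nat.le_induction generalizing W with
  | base => simp
  | succ s hns ih =>
    have h1 := ih (W / 2)
    rw [Nat.div_div_eq_div_mul, ← pow_succ', ← Nat.sub_add_comm hns] at h1
    rw [spread_succ]
    have h2 : ((W % 2 : ℕ) : ℝ) / 2 ^ e s ≤ 1 / 2 ^ (s + 1) := by
      have h3 : ((W % 2 : ℕ) : ℝ) ≤ 1 := by exact_mod_cast Nat.lt_succ_iff.1 (Nat.mod_lt W two_pos)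
      gcongr
      · exact one_le_two
      · exact he s
    have h3 : (0 : ℝ) ≤ ((W % 2 : ℕ) : ℝ) / 2 ^ e s := by positivity
    have h4 : (1 : ℝ) / 2 ^ s = 1 / 2 ^ (s + 1) + 1 / 2 ^ (s + 1) := by
      rw [pow_succ]; field_simp; norm_num
    constructor
    · linarith [h1.1]
    · linarith [h1.2]

theorem spread_le_one {e : ℕ → ℕ} (he : ∀ i, i < e i) (s W : ℕ) : spread e s W ≤ 1 := by
  have h := (spread_trunc he (Nat.zero_le s) W).2
  have h1 : (0 : ℝ) ≤ 1 / 2 ^ s := by positivity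
  simp only [spread, Finset.range_zero, Finset.sum_empty, pow_zero] at h ⊢
  linarith

theorem spread_val_pre (e : ℕ → ℕ) (X : ℕ → Bool) (n : ℕ) :
    spread e n (val (pre X n)) = ∑ i ∈ Finset.range n, ((X i).toNat : ℝ) / 2 ^ e i := by
  induction n with
  | zero => simp [spread]
  | succ n ih =>
    rw [spread_succ, pre_succ, val_append_singleton, Finset.sum_range_succ, ← ih]
    have h1 : (2 * val (pre X n) + (X n).toNat) / 2 = val (pre X n) := by
      cases X n <;> simp
      omega
    have h2 : (2 * val (pre X n) + (X n).toNat) % 2 = (X n).toNat := by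
      cases X n <;> simp
    rw [h1, h2]

open Classical in
/-- The sequence with the digit `X i` at position `e i - 1`, and zeros elsewhere. -/
noncomputable def spreadSeq (e : ℕ → ℕ) (X : ℕ → Bool) (k : ℕ) : Bool :=
  decide (∃ i, e i = k + 1 ∧ X i = true)

theorem spreadSeq_apply {e : ℕ → ℕ} (he : StrictMono e) (X : ℕ → Bool) {i k : ℕ}
    (h : e i = k + 1) : spreadSeq e X k = X i := by
  classical
  rw [spreadSeq]
  cases hX : X i
  · rw [decide_eq_false_iff_not]
    rintro ⟨j, hj, hXj⟩
    rw [he.injective (hj.trans h.symm), hX] at hXj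
    exact Bool.false_ne_true hXj
  · exact decide_eq_true ⟨i, h, hX⟩

theorem spreadSeq_eq_false {e : ℕ → ℕ} (X : ℕ → Bool) {k : ℕ} (h : ∀ i, e i ≠ k + 1) :
    spreadSeq e X k = false := by
  rw [spreadSeq, decide_eq_false_iff_not]
  rintro ⟨i, hi, -⟩
  exact h i hi

theorem binaryValue_spreadSeq {e : ℕ → ℕ} (he : StrictMono e) (hlt : ∀ i, i < e i) {X : ℕ → Bool}
    {L : ℝ} (hL : HasSum (fun i => ((X i).toNat : ℝ) / 2 ^ e i) L) :
    binaryValue (spreadSeq e X) = L := by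
  have hpos : ∀ i, e i = (e i - 1) + 1 := fun i => by have := hlt i; omega
  have hinj : Function.Injective fun i => e i - 1 := fun i j h => by
    refine he.injective ?_
    rw [hpos i, hpos j]
    exact congrArg (· + 1) h
  refine (hasSum_binaryValue _).unique
    ((hinj.hasSum_iff fun k hk => ?_).1 (hL.congr_fun fun i => ?_))
  · have : spreadSeq e X k = false := spreadSeq_eq_false X fun i hi =>
      hk ⟨i, by simp only [hi, Nat.add_sub_cancel]⟩
    simp [digitTerm, this]
  · simp only [Function.comp_apply, digitTerm, spreadSeq_apply he X (hpos i), ← hpos i]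
    cases X i <;> simp

/-- If the digits of `W s / 2 ^ s` and the places they are moved to converge, the numbers converge
to the one given by the limit digits and the limit places. -/
theorem eq_binaryValue_of_tendsto {e : ℕ → ℕ → ℕ} {e' : ℕ → ℕ} {W : ℕ → ℕ} {X : ℕ → Bool} {L : ℝ}
    (hW : ∀ n, ∀ᶠ s in atTop, W s / 2 ^ (s - n) = val (pre X n))
    (he : ∀ i, ∀ᶠ s in atTop, e s i = e' i) (hlt : ∀ s i, i < e s i)
    (he' : StrictMono e') (hlt' : ∀ i, i < e' i)
    (hL : Tendsto (fun s => spread (e s) s (W s)) atTop (𝓝 L)) :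
    L = binaryValue (spreadSeq e' X) := by
  have hclose : ∀ n, |∑ i ∈ Finset.range n, ((X i).toNat : ℝ) / 2 ^ e' i - L| ≤ (1 / 2) ^ n := by
    intro n
    have hev : ∀ᶠ s in atTop, ∀ i ∈ Finset.range n, e s i = e' i :=
      (eventually_all_finset _).2 fun i _ => he i
    have h1 : ∀ᶠ s in atTop,
        |spread e' n (val (pre X n)) - spread (e s) s (W s)| ≤ (1 / 2) ^ n := by
      filter_upwards [hev, hW n, eventually_ge_atTop n] with s h1 h2 h3
      have h4 := spread_trunc (hlt s) h3 (W s)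
      rw [h2, spread_congr fun i hi => h1 i (Finset.mem_range.2 hi)] at h4
      have h5 : (0 : ℝ) ≤ 1 / 2 ^ s := by positivity
      rw [one_div, inv_pow, ← one_div, abs_le]
      constructor <;> linarith [h4.1, h4.2]
    rw [← spread_val_pre]
    exact le_of_tendsto (tendsto_const_nhds.sub hL).abs h1
  refine (binaryValue_spreadSeq he' hlt' ?_).symm
  rw [hasSum_iff_tendsto_nat_of_nonneg fun i => by positivity]
  rw [tendsto_iff_dist_tendsto_zero]
  exact squeeze_zero (fun n => dist_nonneg) (fun n => by rw [Real.dist_eq]; exact hclose n)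
    (tendsto_pow_atTop_nhds_zero_of_lt_one (by norm_num) (by norm_num))

/-! ### Blocks that survive while `h` stays large -/

/-- The number of `t ≤ s` beyond `j` with `h t ≤ h j`. -/
def kills (h : ℕ → ℕ) (s j : ℕ) : ℕ :=
  ∑ t ∈ Finset.range (s + 1), if (decide (j < t) && decide (h t ≤ h j)) = true then 1 else 0

/-- Whether block `j` is still present at stage `s`: it is removed at the first stage `t > j` with
`h t ≤ h j`. -/
def active (h : ℕ → ℕ) (s j : ℕ) : Bool := decide (kills h s j = 0)

theorem active_iff {h : ℕ → ℕ} {s j : ℕ} :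
    active h s j = true ↔ ∀ t ≤ s, j < t → h j < h t := by
  simp [active, kills]

/-- Block `j` is never removed. -/
def Permanent (h : ℕ → ℕ) (j : ℕ) : Prop := ∀ t, j < t → h j < h t

/-- The length of block `j` at stage `s`, `0` if it has been removed. The powers of `4` make a
block at least twice as long as everything before it. -/
def blockLen (h : ℕ → ℕ) (s j : ℕ) : ℕ := if active h s j = true then 4 ^ (j + 1) else 0

theorem blockLen_le (h : ℕ → ℕ) (s j : ℕ) : blockLen h s j ≤ 4 ^ (j + 1) := by
  rw [blockLen]
  split
  · exact le_rfl
  · exact Nat.zero_le _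

theorem blockLen_succ_le (h : ℕ → ℕ) (s j : ℕ) : blockLen h (s + 1) j ≤ blockLen h s j := by
  rw [blockLen, blockLen]
  split
  · rename_i h1
    rw [if_pos (active_iff.2 fun t ht hj => active_iff.1 h1 t (ht.trans (Nat.le_succ s)) hj)]
  · exact Nat.zero_le _

/-- The place of digit `i` at stage `s`, when block `j` of zeros is inserted before digit `j`. The
digit at place `n` has the value `2 ^ (-n)`. -/
def place (h : ℕ → ℕ) (s i : ℕ) : ℕ := i + 1 + ∑ j ∈ Finset.range (i + 1), blockLen h s j

open Classical in
/-- The place of digit `i` in the limit. -/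
noncomputable def limPlace (h : ℕ → ℕ) (i : ℕ) : ℕ :=
  i + 1 + ∑ j ∈ Finset.range (i + 1), if Permanent h j then 4 ^ (j + 1) else 0

theorem strictMono_place (h : ℕ → ℕ) (s : ℕ) : StrictMono (place h s) :=
  strictMono_nat_of_lt_succ fun i => by
    rw [place, place, Finset.sum_range_succ _ (i + 1)]
    omega

theorem lt_place (h : ℕ → ℕ) (s i : ℕ) : i < place h s i := by rw [place]; omega

theorem place_succ_le (h : ℕ → ℕ) (s i : ℕ) : place h (s + 1) i ≤ place h s i :=
  Nat.add_le_add_left (Finset.sum_le_sum fun j _ => blockLen_succ_le h s j) _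

theorem limPlace_succ (h : ℕ → ℕ) (i : ℕ) [Decidable (Permanent h (i + 1))] :
    limPlace h (i + 1) = limPlace h i + 1 + if Permanent h (i + 1) then 4 ^ (i + 2) else 0 := by
  rw [limPlace, limPlace, Finset.sum_range_succ _ (i + 1)]
  by_cases hp : Permanent h (i + 1)
  · rw [if_pos hp, if_pos hp, show i + 1 + 1 = i + 2 from rfl]
    omega
  · rw [if_neg hp, if_neg hp]
    omega

theorem strictMono_limPlace (h : ℕ → ℕ) : StrictMono (limPlace h) :=
  strictMono_nat_of_lt_succ fun i => by
    classical
    rw [limPlace_succ]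
    omega

theorem lt_limPlace (h : ℕ → ℕ) (i : ℕ) : i < limPlace h i := by rw [limPlace]; omega

theorem eventually_place_eq (h : ℕ → ℕ) (i : ℕ) :
    ∀ᶠ s in atTop, place h s i = limPlace h i := by
  have h1 : ∀ j, ∀ᶠ s in atTop, (active h s j = true ↔ Permanent h j) := by
    intro j
    by_cases hp : Permanent h j
    · exact Eventually.of_forall fun s =>
        iff_of_true (active_iff.2 fun t _ hj => hp t hj) hp
    · obtain ⟨t, ht⟩ := not_forall.1 hp
      obtain ⟨hjt, hh⟩ := Classical.not_imp.1 ht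
      filter_upwards [eventually_ge_atTop t] with s hs
      exact iff_of_false (fun ha => hh (active_iff.1 ha t hs hjt)) hp
  have h2 : ∀ᶠ s in atTop, ∀ j ∈ Finset.range (i + 1), (active h s j = true ↔ Permanent h j) :=
    (eventually_all_finset _).2 fun j _ => h1 j
  filter_upwards [h2] with s hs
  rw [place, limPlace]
  congr 1
  refine Finset.sum_congr rfl fun j hj => ?_
  rw [blockLen]
  by_cases hp : Permanent h j
  · rw [if_pos hp, if_pos ((hs j hj).2 hp)]
  · rw [if_neg hp, if_neg fun ha => hp ((hs j hj).1 ha)]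

/-- If `h` has a finite limit inferior, only finitely many blocks remain, and the sequence with the
blocks inserted has the same tail as `X`. -/
theorem MLRandomSeq.spreadSeq_limPlace {h : ℕ → ℕ} {X : ℕ → Bool} (hX : MLRandomSeq X)
    (hh : ∃ v, ∃ᶠ t in atTop, h t ≤ v) : MLRandomSeq (spreadSeq (limPlace h) X) := by
  classical
  have hfin : ∀ᶠ j in atTop, ¬ Permanent h j := by
    rw [← not_frequently]
    intro hinf
    have hlt : ∀ j, Permanent h j → h j < Nat.find hh := by
      intro j hj
      obtain ⟨t, ht, hv⟩ := frequently_atTop.1 (Nat.find_spec hh) (j + 1)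
      exact (hj t ht).trans_le hv
    obtain ⟨j, hj⟩ := hinf.exists
    have hpos := hlt j hj
    refine Nat.find_min hh (Nat.sub_one_lt_of_lt hpos) (hinf.mono fun j hj => ?_)
    exact Nat.le_sub_one_of_lt (hlt j hj)
  obtain ⟨J, hJ⟩ := eventually_atTop.1 hfin
  have hplace : ∀ n, limPlace h (J + n) = limPlace h J + n := by
    intro n
    induction n with
    | zero => rfl
    | succ n ih =>
      rw [← add_assoc, limPlace_succ, if_neg (hJ _ (by omega)), ih]
      rfl
  refine hX.of_tail (limPlace h J - 1) J fun n => spreadSeq_apply (strictMono_limPlace h) X ?_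
  have := lt_limPlace h J
  rw [hplace]
  omega

/-- The last `j` with `h j ≤ h N` is such a block. -/
theorem exists_permanent {h : ℕ → ℕ} (hh : ∀ v, ∀ᶠ t in atTop, v < h t) (N : ℕ) :
    ∃ j ≥ N, Permanent h j := by
  have hex : ∃ T, ∀ t ≥ T, h N < h t := eventually_atTop.1 (hh (h N))
  classical
  have hspec := Nat.find_spec hex
  have hN : N < Nat.find hex := by
    by_contra hle
    exact lt_irrefl _ (hspec N (not_lt.1 hle))
  refine ⟨Nat.find hex - 1, by omega, fun t ht => ?_⟩
  have h1 := Nat.find_min hex (Nat.sub_one_lt_of_lt hN)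
  simp only [not_forall, not_lt] at h1
  obtain ⟨u, hu, hle⟩ := h1
  obtain rfl : u = Nat.find hex - 1 := by
    by_contra hne
    exact absurd (hspec u (by omega)) (not_lt.2 hle)
  exact hle.trans_lt (hspec t (by omega))

theorem two_mul_sum_le (j : ℕ) : 2 * (j + ∑ i ∈ Finset.range j, 4 ^ (i + 1)) ≤ 4 ^ (j + 1) := by
  induction j with
  | zero => simp
  | succ j ih =>
    have h1 : 1 < 4 ^ (j + 1) := Nat.one_lt_pow (by omega) (by norm_num)
    rw [Finset.sum_range_succ, pow_succ 4 (j + 1)]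
    omega

theorem two_mul_limPlace_le (h : ℕ → ℕ) (j : ℕ) : 2 * limPlace h j ≤ 4 ^ (j + 2) := by
  refine le_trans (Nat.mul_le_mul_left 2 (Nat.add_le_add_left (Finset.sum_le_sum fun i _ => ?_) _))
    (two_mul_sum_le (j + 1))
  split
  · exact le_rfl
  · exact Nat.zero_le _

/-- If `h` tends to infinity, infinitely many blocks remain. -/
theorem not_schnorrRandomSeq_spreadSeq {h : ℕ → ℕ} (hh : ∀ v, ∀ᶠ t in atTop, v < h t)
    (X : ℕ → Bool) : ¬ SchnorrRandomSeq (spreadSeq (limPlace h) X) := by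
  classical
  refine not_schnorrRandomSeq_of_blocks (b := false) fun N => ?_
  obtain ⟨j, hj, hp⟩ := exists_permanent hh (N + 1)
  obtain ⟨i, rfl⟩ : ∃ i, j = i + 1 := ⟨j - 1, by omega⟩
  have hlt := lt_limPlace h i
  refine ⟨limPlace h i, by omega, fun k hk1 hk2 => spreadSeq_eq_false X fun l hl => ?_⟩
  have h1 := two_mul_limPlace_le h i
  have h2 := limPlace_succ h i
  rw [if_pos hp] at h2
  rcases Nat.lt_or_ge i l with hil | hil
  · have := (strictMono_limPlace h).monotone (Nat.succ_le_of_lt hil)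
    simp only [Nat.succ_eq_add_one] at this
    omega
  · have := (strictMono_limPlace h).monotone hil
    omega

/-! ### The reduction -/

/-- The exponent of the common denominator of the places at stage `s`. -/
def placeBound (s : ℕ) : ℕ := s + 1 + ∑ j ∈ Finset.range (s + 1), 4 ^ (j + 1)

/-- The numerator, over `2 ^ placeBound s`, of `W s / 2 ^ s` with the blocks present inserted. -/
def spreadNum (W : ℕ → ℕ) (h : ℕ → ℕ) (s : ℕ) : ℕ :=
  ∑ i ∈ Finset.range s, W s / 2 ^ (s - 1 - i) % 2 * 2 ^ (placeBound s - place h s i)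

theorem spreadNum_div (W h : ℕ → ℕ) (s : ℕ) :
    (spreadNum W h s : ℝ) / 2 ^ placeBound s = spread (place h s) s (W s) := by
  rw [spreadNum, spread, Nat.cast_sum, Finset.sum_div]
  refine Finset.sum_congr rfl fun i hi => ?_
  have hle : place h s i ≤ placeBound s := by
    have hi := Finset.mem_range.1 hi
    refine add_le_add (by omega) ?_
    exact le_trans (Finset.sum_le_sum fun j _ => blockLen_le h s j)
      (Finset.sum_le_sum_of_subset (Finset.range_subset_range.2 (by omega)))
  obtain ⟨k, hk⟩ := Nat.exists_eq_add_of_le hle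
  rw [hk, Nat.add_sub_cancel_left, pow_add]
  push_cast
  field_simp

theorem computable_kills {h : ℕ → ℕ → ℕ} (hh : Computable₂ h) :
    Computable fun y : (ℕ × ℕ) × ℕ => kills (h y.1.1) y.1.2 y.2 := by
  have hj : Computable fun y : ((ℕ × ℕ) × ℕ) × ℕ => y.1.2 := Computable.snd.comp Computable.fst
  have hx : Computable fun y : ((ℕ × ℕ) × ℕ) × ℕ => y.1.1.1 :=
    Computable.fst.comp (Computable.fst.comp Computable.fst)
  have ht : Computable fun y : ((ℕ × ℕ) × ℕ) × ℕ =>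
      if (decide (y.1.2 < y.2) && decide (h y.1.1.1 y.2 ≤ h y.1.1.1 y.1.2)) = true then 1 else 0 :=
    computable_ite (computable_and (computable_decide_lt hj Computable.snd)
      (computable_decide_le (hh.comp hx Computable.snd) (hh.comp hx hj)))
      (Computable.const 1) (Computable.const 0)
  exact computable_sum_range (f := fun (y : (ℕ × ℕ) × ℕ) t =>
    if (decide (y.2 < t) && decide (h y.1.1 t ≤ h y.1.1 y.2)) = true then 1 else 0) ht.to₂
    (computable_add (Computable.snd.comp Computable.fst) (Computable.const 1))

theorem computable_active {h : ℕ → ℕ → ℕ} (hh : Computable₂ h) :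
    Computable fun y : (ℕ × ℕ) × ℕ => active (h y.1.1) y.1.2 y.2 :=
  computable_decide_eq (computable_kills hh) (Computable.const 0)

theorem computable_blockLen {h : ℕ → ℕ → ℕ} (hh : Computable₂ h) :
    Computable fun y : (ℕ × ℕ) × ℕ => blockLen (h y.1.1) y.1.2 y.2 :=
  computable_ite (computable_active hh) (computable_pow (Computable.const 4)
    (computable_add Computable.snd (Computable.const 1))) (Computable.const 0)

theorem computable_place {h : ℕ → ℕ → ℕ} (hh : Computable₂ h) :
    Computable fun y : (ℕ × ℕ) × ℕ => place (h y.1.1) y.1.2 y.2 := by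
  have hi : Computable fun y : (ℕ × ℕ) × ℕ => y.2 + 1 :=
    computable_add Computable.snd (Computable.const 1)
  have hj : Computable fun y : ((ℕ × ℕ) × ℕ) × ℕ => (y.1.1, y.2) :=
    (Computable.fst.comp Computable.fst).pair Computable.snd
  exact computable_add hi (computable_sum_range (f := fun (y : (ℕ × ℕ) × ℕ) j =>
    blockLen (h y.1.1) y.1.2 j) ((computable_blockLen hh).comp hj).to₂ hi)

theorem computable_placeBound : Computable placeBound := by
  have hi : Computable fun s : ℕ => s + 1 := computable_add Computable.id (Computable.const 1)
  have ht : Computable fun y : ℕ × ℕ => 4 ^ (y.2 + 1) :=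
    computable_pow (Computable.const 4) (computable_add Computable.snd (Computable.const 1))
  exact computable_add hi (computable_sum_range (f := fun _ j => 4 ^ (j + 1)) ht.to₂ hi)

theorem computable_spreadNum {W : ℕ → ℕ} (hW : Computable W) {h : ℕ → ℕ → ℕ}
    (hh : Computable₂ h) : Computable₂ fun x s => spreadNum W (h x) s := by
  have hs : Computable fun y : (ℕ × ℕ) × ℕ => y.1.2 := Computable.snd.comp Computable.fst
  have hd : Computable fun y : (ℕ × ℕ) × ℕ => W y.1.2 / 2 ^ (y.1.2 - 1 - y.2) % 2 :=
    computable_mod (computable_div (hW.comp hs) (computable_pow (Computable.const 2)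
      (computable_sub (computable_sub hs (Computable.const 1)) Computable.snd)))
      (Computable.const 2)
  have hp : Computable fun y : (ℕ × ℕ) × ℕ =>
      2 ^ (placeBound y.1.2 - place (h y.1.1) y.1.2 y.2) :=
    computable_pow (Computable.const 2)
      (computable_sub (computable_placeBound.comp hs) (computable_place hh))
  exact computable_sum_range (f := fun (y : ℕ × ℕ) i =>
    W y.2 / 2 ^ (y.2 - 1 - i) % 2 * 2 ^ (placeBound y.2 - place (h y.1) y.2 i))
    (computable_mul hd hp).to₂ Computable.snd

theorem exists_numbering_of_isSigma3 {A : Set ℕ} (hA : IsSigma3 A) :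
    ∃ β, IsLeftRENumbering β ∧
      ∀ x, (x ∈ A → MLRandom (β x)) ∧ (x ∉ A → ¬ SchnorrRandom (β x)) := by
  obtain ⟨h, hh, hAh⟩ := hA.exists_liminf
  obtain ⟨W, X, hWc, hW2, hWlt, hX, hWX⟩ := exists_random_approximation
  have hmono : ∀ x, Monotone fun s => (spreadNum W (h x) s : ℝ) / 2 ^ placeBound s := by
    intro x
    refine monotone_nat_of_le_succ fun s => ?_
    rw [spreadNum_div, spreadNum_div]
    have h1 : spread (place (h x) (s + 1)) (s + 1) (2 * W s)
        = spread (place (h x) (s + 1)) s (W s) := by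
      rw [spread_succ]
      simp
    -- Pass to the new places first, then to the new numeral.
    calc spread (place (h x) s) s (W s) ≤ spread (place (h x) (s + 1)) s (W s) :=
          spread_anti (fun i _ => place_succ_le (h x) s i) _
      _ = spread (place (h x) (s + 1)) (s + 1) (2 * W s) := h1.symm
      _ ≤ _ := spread_mono (strictMono_place _ _) (hW2 s) (hWlt _)
  obtain ⟨β, hβ, hlim⟩ := exists_numbering (E := fun _ s => placeBound s)
    (computable_spreadNum hWc hh) (computable_placeBound.comp Computable.snd).to₂
    (fun x => by simp [spreadNum]) hmono
    (fun x s => by rw [spreadNum_div]; exact spread_le_one (lt_place _ _) _ _)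
  have hval : ∀ x, β x = binaryValue (spreadSeq (limPlace (h x)) X) := by
    intro x
    refine eq_binaryValue_of_tendsto hWX (eventually_place_eq (h x)) (lt_place (h x))
      (strictMono_limPlace _) (lt_limPlace _) ?_
    simpa only [spreadNum_div] using hlim x
  refine ⟨β, hβ, fun x => ⟨fun hx => ?_, fun hx => ?_⟩⟩
  · exact ⟨_, (hval x).symm, hX.spreadSeq_limPlace ((hAh x).1 hx)⟩
  · rw [hval x]
    refine not_schnorrRandom_binaryValue (not_schnorrRandomSeq_spreadSeq (fun v => ?_) X)
    have h1 : ¬ ∃ᶠ t in atTop, h x t ≤ v := fun h2 => hx ((hAh x).2 ⟨v, h2⟩)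
    simpa only [not_frequently, not_le] using h1

theorem IsAcceptableLeftRENumbering.exists_reduction {α : ℕ → ℝ}
    (hα : IsAcceptableLeftRENumbering α) {A : Set ℕ} (hA : IsSigma3 A) :
    ∃ g : ℕ → ℕ, Computable g ∧ ∀ x,
      (x ∈ A → MLRandom (α (g x))) ∧ (x ∉ A → ¬ SchnorrRandom (α (g x))) := by
  obtain ⟨β, hβ, hβA⟩ := exists_numbering_of_isSigma3 hA
  obtain ⟨g, hg, hgβ⟩ := hα.2 β hβ
  exact ⟨g, hg, fun x => by rw [hgβ]; exact hβA x⟩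

/-- A class of reals between the Martin-Löf random and the Schnorr random ones has a `Σ₃`-hard index
set. -/
theorem IsAcceptableLeftRENumbering.isSigma3Hard {α : ℕ → ℝ}
    (hα : IsAcceptableLeftRENumbering α) {C : ℝ → Prop} (h1 : ∀ r, MLRandom r → C r)
    (h2 : ∀ r, C r → SchnorrRandom r) : IsSigma3Hard {e | C (α e)} := by
  intro A hA
  obtain ⟨g, hg, hgA⟩ := hα.exists_reduction hA
  exact ⟨g, hg, fun x => ⟨fun hx => h1 _ ((hgA x).1 hx),
    fun hx => by_contra fun hn => (hgA x).2 hn (h2 _ hx)⟩⟩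

end LeftRE

theorem mainTheorem2 (α : ℕ → ℝ) (hα : LeftRE.IsAcceptableLeftRENumbering α)
    (hu : LeftRE.IsUniversalLeftRENumbering α) :
    (∀ A : Set ℕ, LeftRE.IsSigma3 A →
      ∃ g : ℕ → ℕ, Computable g ∧ ∀ x,
        (x ∈ A → LeftRE.MLRandom (α (g x))) ∧
        (x ∉ A → ¬ LeftRE.SchnorrRandom (α (g x)))) ∧
    LeftRE.IsSigma3Hard {e | LeftRE.MLRandom (α e)} ∧
    LeftRE.IsSigma3Hard {e | LeftRE.ComputablyRandom (α e)} ∧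
    LeftRE.IsSigma3Hard {e | LeftRE.SchnorrRandom (α e)} :=
  ⟨fun _ hA => hα.exists_reduction hA,
    hα.isSigma3Hard (fun _ h => h) fun _ h => h.computablyRandom.schnorrRandom,
    hα.isSigma3Hard (fun _ h => h.computablyRandom) fun _ h => h.schnorrRandom,
    hα.isSigma3Hard (fun _ h => h.computablyRandom.schnorrRandom) fun _ h => h⟩
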